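/- Trees are finite rooted trees with root $\emptyset$; a leaf is a vertex without children, the other vertices are internal. For a tree $\mathcal T$ and $u\in\mathcal T$, $\mathcal T_u$ is the subtree formed by $u$ and its descendants, rooted at $u$. A homomorphism $\varphi:\mathcal T\to\mathcal P$ sends root to root and children of $u$ to children of $\varphi(u)$; $\varphi_u:\mathcal T_u\to\mathcal P_{\varphi(u)}$ is its restriction. **Tree compositions.** $\mathsf C(\mathcal T,\mathcal P)$ is the set of surjective homomorphisms $\varphi:\mathcal T\to\mathcal P$ that send leaves to leaves and such that, whenever $u\ne v$ are internal siblings with $\varphi(u)=\varphi(v)$, there is $g\in\mathrm{Aut}(\mathcal T)$ with $g(u)=v$ and $\varphi_u=\varphi_v\circ g|_{\mathcal T_u}$. Two compositions $\varphi_i\in\mathsf C(\mathcal T_i,\mathcal P_i)$ are equivalent if $\omega\circ\varphi_1=\varphi_2\circ\tau$ for some tree isomorphisms $\tau:\mathcal T_1\to\mathcal T_2$, $\omega:\mathcal P_1\to\mathcal P_2$; they are strictly equivalent if moreover $\mathcal P_1=\mathcal P_2$ and $\omega$ is the identity. **Quotient and tree of partitions.** The quotient of $\varphi\in\mathsf C(\mathcal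 T,\mathcal P)$ is the composition $\alpha\in\mathsf C(\mathcal P,\mathcal Q)$ (unique up to isomorphism) such that: (a) for each internal $x\in\mathcal P$, all leaves among the children of $x$ are sent to the unique leaf among the children of $\alpha(x)$; (b) if $a\neq b$ are internal siblings in $\mathcal Q$ and $u,v$ are siblings in $\mathcal T$ with $\alpha(\varphi(u))=a$, $\alpha(\varphi(v))=b$, then $\varphi_u$ and $\varphi_v$ are not equivalent; (c) if $u,w$ are internal and $\alpha(\varphi(u))=\alpha(\varphi(w))$, then $\varphi_u,\varphi_w$ are equivalent and $(\alpha\circ\varphi)_u,(\alpha\circ\varphi)_w$ are strictly equivalent. The tree of partitions $(\Lambda,\mathcal Q)$ of $\varphi$ assigns to each non-root $b\in\mathcal Q$, with parent $a$, the integer partition $\lambda^b$ whose parts are the numbers $|\{w \text{ child of } u:\varphi(w)=y\}|$, where $u$ is any vertex with $\alpha(\varphi(u))=a$ and $y$ runs over the children of $\varphi(u)$ with $\alpha(y)=b$. Labelings $\Lambda,\Xi$ are isomorphic, $\Lambda\equiv\Xi$, if a tree isomorphism carries one to the other at all non-root vertices. $\Lambda_a$ is the restriction of $\Lambda$ to $\mathcal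 Q_a$, with $a$ as unlabeled root. **Total order.** Partitions (possibly of different integers) are compared lexicographically, a proper initial segment being smaller. Trees of partitions are compared by induction on the maximum $h$ of their heights. For children $a,b$ of the roots of $(\Lambda,\mathcal Q)$, $(\Xi,\mathcal N)$ write $a\equiv'b$ if $\lambda^a=\xi^b$ and either $a,b$ are both leaves, or both are internal and $\Lambda_a\equiv\Xi_b$. If $a\not\equiv'b$, write $a>'b$ if: both are leaves and $\lambda^a>\xi^b$; or $a$ is internal and $b$ is a leaf; or both are internal and either $\Lambda_a>\Xi_b$, or $\Lambda_a\equiv\Xi_b$ and $|\lambda^a|>|\xi^b|$, or $\Lambda_a\equiv\Xi_b$, $|\lambda^a|=|\xi^b|$ and $\lambda^a>\xi^b$. List the children of the two roots decreasingly, $a_1>'\dots>'a_l$ and $b_1>'\dots>'b_k$. Then $\Lambda>\Xi$ if either $l>k$ and $a_i\equiv'b_i$ for all $i\le k$, or for some $j\le\min(l,k)$ one has $a_i\equiv'b_i$ for $i<j$ and $a_j>'b_j$. For tree compositions $\varphi,\psi$ with trees of partitions $\Lambda,\Xi$, $\varphi\le\psi$ means that $\Lambda<\Xi$ or $\Lambda\equiv\Xi$.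 **Transpose.** A transpose of $\varphi\in\mathsf C(\mathcal T,\mathcal P)$, with quotient $\alpha\in\mathsf C(\mathcal P,\mathcal Q)$ and tree of partitions $(\Lambda,\mathcal Q)$, is a composition $\varphi^t\in\mathsf C(\mathcal T,\mathcal P^t)$ with a quotient $\alpha^t\in\mathsf C(\mathcal P^t,\mathcal Q)$ such that $\alpha^t\circ\varphi^t=\alpha\circ\varphi$, the tree of partitions of $\varphi^t$ is $b\mapsto(\lambda^b)^t$ (conjugate partitions), and $|\varphi^{-1}(x)\cap(\varphi^t)^{-1}(y)|\le1$ for all internal $u\in\mathcal T$ and all children $x$ of $\varphi(u)$, $y$ of $\varphi^t(u)$. **Coarsest common refinement.** A common refinement of $\varphi\in\mathsf C(\mathcal T,\mathcal P)$ and $\psi\in\mathsf C(\mathcal T,\mathcal M)$ consists of compositions $\rho\in\mathsf C(\mathcal T,\mathcal R)$, $\vartheta\in\mathsf C(\mathcal R,\mathcal P)$, $\tau\in\mathsf C(\mathcal R,\mathcal M)$ with $\vartheta\circ\rho=\varphi$ and $\tau\circ\rho=\psi$. It is the coarsest one if, for all distinct siblings $a,b\in\mathcal R$ with $\vartheta(a)=\vartheta(b)$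 and $\tau(a)=\tau(b)$ and all $u,v$ with $\rho(u)=a$, $\rho(v)=b$, there are no tree isomorphisms $\zeta:\mathcal T_u\to\mathcal T_v$, $\gamma:\mathcal R_a\to\mathcal R_b$ with $\varphi_v\zeta=\varphi_u$, $\psi_v\zeta=\psi_u$, $\rho_v\zeta=\gamma\rho_u$, $\vartheta_b\gamma=\vartheta_a$, $\tau_b\gamma=\tau_a$. It is trivial if $\rho$ is an isomorphism. **Theorem.** Let $\varphi\in\mathsf C(\mathcal T,\mathcal P)$ and $\psi\in\mathsf C(\mathcal T,\mathcal M)$ be tree compositions of a finite rooted tree $\mathcal T$ whose coarsest common refinement is trivial. Then $\varphi\le\psi^t$ for every transpose $\psi^t$ of $\psi$, and $\psi\le\varphi^t$ for every transpose $\varphi^t$ of $\varphi$. -/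

import Mathlib

/-!
Finite rooted trees are Mathlib's `RootedTree`s with a finite set of vertices: the order is the
ancestor order, `⊥` is the root and `u ⋖ v` says that `u` is the parent of `v`.
Isomorphisms and automorphisms of rooted trees are order isomorphisms.
-/

universe u

namespace TreeComp

/-- The subtree `T_v` made up of `v` and of all its descendants, rooted at `v`. -/
noncomputable abbrev sub (T : RootedTree.{u}) (v : T) : RootedTree.{u} :=
  (T.subtree v).coeTree

/-- A leaf is a vertex without children; the other vertices are internal. -/
def IsLeaf {T : RootedTree.{u}} (v : T) : Prop := ∀ w : T, ¬ v ⋖ w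

/-- An internal vertex is a vertex with at least one child. -/
def IsInternal {T : RootedTree.{u}} (v : T) : Prop := ∃ w : T, v ⋖ w

/-- Distinct vertices with the same parent. -/
def DistinctSiblings {T : RootedTree.{u}} (v w : T) : Prop :=
  v ≠ w ∧ ∃ p : T, p ⋖ v ∧ p ⋖ w

/-- A rooted tree homomorphism: the root goes to the root and children of `v` go to children of
the image of `v`. -/
structure TreeHom (T P : RootedTree.{u}) where
  toFun : T → P
  map_bot : toFun ⊥ = ⊥
  map_covBy : ∀ v w : T, v ⋖ w → toFun v ⋖ toFun w

instance (T P : RootedTree.{u}) : CoeFun (TreeHom T P) (fun _ => T → P) := ⟨TreeHom.toFun⟩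

theorem TreeHom.monotone {T P : RootedTree.{u}} (φ : TreeHom T P) {v w : T} (h : v ≤ w) :
    φ v ≤ φ w := by
  obtain ⟨n, hn⟩ := h.exists_pred_iterate
  induction n generalizing w with
  | zero => simp_all
  | succ n ih =>
    rw [Function.iterate_succ_apply] at hn
    by_cases hm : IsMin w
    · have : v = w := le_antisymm h (hm h)
      rw [this]
    · have h1 : v ≤ Order.pred w := hn ▸ Order.pred_iterate_le n _
      exact (ih h1 hn).trans (φ.map_covBy _ _ (Order.pred_covBy_of_not_isMin hm)).le

theorem covBy_of_sub {T : RootedTree.{u}} {v : T} {a b : sub T v} (h : a ⋖ b) :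
    (a : T) ⋖ (b : T) :=
  ⟨h.lt, fun c hac hcb => h.2 (c := ⟨c, a.2.trans hac.le⟩) hac hcb⟩

theorem sub_covBy {T : RootedTree.{u}} {v : T} {a b : sub T v} (h : (a : T) ⋖ (b : T)) :
    a ⋖ b :=
  ⟨h.lt, fun _ hac hcb => h.2 hac hcb⟩

/-- The restriction `φ_v : T_v → P_{φ(v)}`. -/
noncomputable def TreeHom.restr {T P : RootedTree.{u}} (φ : TreeHom T P) (v : T) :
    TreeHom (sub T v) (sub P (φ v)) where
  toFun w := ⟨φ w, φ.monotone w.2⟩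
  map_bot := rfl
  map_covBy _ _ h := sub_covBy (φ.map_covBy _ _ (covBy_of_sub h))

/-- Tree compositions: surjective rooted tree homomorphisms that send leaves to leaves and satisfy
the regularity condition: if `v, w` are distinct internal siblings with the same image, then there
is an automorphism `g` of `T` with `g v = w` and `φ_v = φ_w ∘ g_v`. -/
structure IsComposition {T P : RootedTree.{u}} (φ : TreeHom T P) : Prop where
  surjective : Function.Surjective φ
  leaf : ∀ v : T, IsLeaf v → IsLeaf (φ v)
  regular : ∀ v w : T, DistinctSiblings v w → IsInternal v → IsInternal w → φ v = φ w →
    ∃ g : T ≃o T, g v = w ∧ ∀ t : T, v ≤ t → φ t = φ (g t)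

/-- Equivalence of tree compositions. -/
def Equivalent {T₁ P₁ T₂ P₂ : RootedTree.{u}} (φ₁ : TreeHom T₁ P₁) (φ₂ : TreeHom T₂ P₂) : Prop :=
  ∃ (τ : T₁ ≃o T₂) (ω : P₁ ≃o P₂), ∀ t : T₁, ω (φ₁ t) = φ₂ (τ t)

/-- `α : P → Q` is the quotient of `φ : T → P`. -/
structure IsQuotient {T P Q : RootedTree.{u}} (φ : TreeHom T P) (α : TreeHom P Q) : Prop where
  composition : IsComposition α
  /-- All the leaves among the children of `x` go to the unique leaf among the children
  of `α x`. -/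
  leaves : ∀ x y : P, x ⋖ y → IsLeaf y →
    IsLeaf (α y) ∧ ∀ b : Q, α x ⋖ b → IsLeaf b → b = α y
  not_equivalent : ∀ a b : Q, DistinctSiblings a b → IsInternal a → IsInternal b →
    ∀ v w : T, DistinctSiblings v w → α (φ v) = a → α (φ w) = b →
      ¬ Equivalent (φ.restr v) (φ.restr w)
  equivalent : ∀ v w : T, IsInternal v → IsInternal w → α (φ v) = α (φ w) →
    Equivalent (φ.restr v) (φ.restr w) ∧
      /- strict equivalence of the compositions of `φ_v` and `φ_w` with the restrictions of `α` -/
      ∃ ζ : sub T v ≃o sub T w, ∀ t : sub T v, α (φ t) = α (φ (ζ t))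

/-! ### Integer partitions and trees of partitions

Integer partitions are represented by Young diagrams; the parts, in weakly decreasing order, are
`YoungDiagram.rowLens`, the sum of the parts is `YoungDiagram.card` and the conjugate partition is
`YoungDiagram.transpose`. -/

/-- The lexicographic order `μ > ν` between partitions of possibly different integers: at the first
index where they differ `μ` has the greater part, or `ν` is a proper initial segment of `μ`. -/
def LexGT (μ ν : YoungDiagram) : Prop := List.Lex (· < ·) ν.rowLens μ.rowLens

/-- A partitional labeling of a rooted tree. The value at the root is irrelevant and it is ignored
everywhere. -/
structure Labeling where
  tree : RootedTree.{u}
  label : tree → YoungDiagram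

/-- The labeling `Λ_a` of the subtree with root `a`. -/
noncomputable def Labeling.sub (Λ : Labeling.{u}) (a : Λ.tree) : Labeling.{u} where
  tree := TreeComp.sub Λ.tree a
  label b := Λ.label b

/-- Isomorphism of partitional labelings. -/
def Labeling.Iso (Λ Ξ : Labeling.{u}) : Prop :=
  ∃ γ : Λ.tree ≃o Ξ.tree, ∀ a : Λ.tree, a ≠ ⊥ → Λ.label a = Ξ.label (γ a)

/-- The first level of a rooted tree, i.e. the set of the children of the root. -/
abbrev FirstLevel (T : RootedTree.{u}) : Type u := {v : T // ⊥ ⋖ v}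

/-- The equivalence relation between first level vertices of two labelings. -/
def VertexEq (Λ Ξ : Labeling.{u}) (a : FirstLevel Λ.tree) (b : FirstLevel Ξ.tree) : Prop :=
  (IsLeaf a.1 ∧ IsLeaf b.1 ∧ Λ.label a = Ξ.label b) ∨
  (IsInternal a.1 ∧ IsInternal b.1 ∧ (Λ.sub a).Iso (Ξ.sub b) ∧ Λ.label a = Ξ.label b)

/-- The strict order `a > b` between first level vertices of two labelings, where `G` is the
strict order `>` between labelings of smaller height. -/
def VertexGT (G : Labeling.{u} → Labeling.{u} → Prop) (Λ Ξ : Labeling.{u})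
    (a : FirstLevel Λ.tree) (b : FirstLevel Ξ.tree) : Prop :=
  ¬ VertexEq Λ Ξ a b ∧
  ((IsLeaf a.1 ∧ IsLeaf b.1 ∧ LexGT (Λ.label a) (Ξ.label b)) ∨
   (IsInternal a.1 ∧ IsLeaf b.1) ∨
   (IsInternal a.1 ∧ IsInternal b.1 ∧ G (Λ.sub a) (Ξ.sub b)) ∨
   (IsInternal a.1 ∧ IsInternal b.1 ∧ (Λ.sub a).Iso (Ξ.sub b) ∧
      (Λ.label a).card > (Ξ.label b).card) ∨
   (IsInternal a.1 ∧ IsInternal b.1 ∧ (Λ.sub a).Iso (Ξ.sub b) ∧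
      (Λ.label a).card = (Ξ.label b).card ∧ LexGT (Λ.label a) (Ξ.label b)))

/-- The strict order `Λ >_h Ξ` between trees of partitions of height at most `h`: the first level
vertices of each tree are listed in decreasing order and the two lists are compared
lexicographically. -/
def GTAt : ℕ → Labeling.{u} → Labeling.{u} → Prop
  | 0, _, _ => False
  | h + 1, Λ, Ξ =>
    ∃ (l k : ℕ) (a : Fin l → FirstLevel Λ.tree) (b : Fin k → FirstLevel Ξ.tree),
      Function.Surjective a ∧ (∀ i j, i < j → VertexGT (GTAt h) Λ Λ (a i) (a j)) ∧
      Function.Surjective b ∧ (∀ i j, i < j → VertexGT (GTAt h) Ξ Ξ (b i) (b j)) ∧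
      ((∃ hl : k < l, ∀ i : Fin k, VertexEq Λ Ξ (a (i.castLE hl.le)) (b i)) ∨
       (∃ (j : ℕ) (hl : j < l) (hk : j < k),
          (∀ (i : ℕ) (hi : i < j), VertexEq Λ Ξ (a ⟨i, hi.trans hl⟩) (b ⟨i, hi.trans hk⟩)) ∧
          VertexGT (GTAt h) Λ Ξ (a ⟨j, hl⟩) (b ⟨j, hk⟩)))

/-- The height of a finite rooted tree: the greatest level of a vertex, where the level of `v` is
the number of its proper ancestors. -/
noncomputable def height (T : RootedTree.{u}) : ℕ := ⨆ v : T, (Set.Iio v).ncard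

/-- `Λ ≥ Ξ` for trees of partitions, up to isomorphism. -/
def Labeling.GE (Λ Ξ : Labeling.{u}) : Prop :=
  GTAt (max (height Λ.tree) (height Ξ.tree)) Λ Ξ ∨ Λ.Iso Ξ

/-- `lab` is the partitional labeling determined by `φ : T → P` and by its quotient `α : P → Q`:
if `b` is a child of `α (φ v)` then the parts of the partition at `b` are the cardinalities of the
sets of the children of `v` that are sent to `y`, where `y` runs over the children of `φ v` with
`α y = b`. -/
def IsTypeLabel {T P Q : RootedTree.{u}} (φ : TreeHom T P) (α : TreeHom P Q)
    (lab : Q → YoungDiagram) : Prop :=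
  ∀ (v : T) (b : Q), α (φ v) ⋖ b →
    ∃ e : Fin (lab b).rowLens.length ≃ {y : P // φ v ⋖ y ∧ α y = b},
      ∀ i, (lab b).rowLens.get i = Nat.card {w : T // v ⋖ w ∧ φ w = (e i).1}

/-- `Λ` is the tree of partitions associated to `φ`. -/
def IsTreeOfPartitions {T P : RootedTree.{u}} (φ : TreeHom T P) (Λ : Labeling.{u}) : Prop :=
  ∃ α : TreeHom P Λ.tree, IsQuotient φ α ∧ IsTypeLabel φ α Λ.label

/-- `φ ≤ ψ` for tree compositions: their trees of partitions satisfy `Λ ≤ Ξ`. -/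
def CompLE {T P T' P' : RootedTree.{u}} (φ : TreeHom T P) (ψ : TreeHom T' P') : Prop :=
  ∃ Λ Ξ : Labeling.{u}, IsTreeOfPartitions φ Λ ∧ IsTreeOfPartitions ψ Ξ ∧ Ξ.GE Λ

/-- `0-1` intersection of two tree compositions of the same tree. -/
def ZeroOneIntersection {T P M : RootedTree.{u}} (φ : TreeHom T P) (ψ : TreeHom T M) : Prop :=
  ∀ v : T, IsInternal v → ∀ (x : P) (y : M), φ v ⋖ x → ψ v ⋖ y →
    {t : T | φ t = x ∧ ψ t = y}.Subsingleton

/-- `φt` is a transpose of `φ`: the two compositions have the same quotient tree `Q`, the same map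
`T → Q`, conjugate trees of partitions, and `0-1` intersection. -/
def IsTranspose {T P P' : RootedTree.{u}} (φ : TreeHom T P) (φt : TreeHom T P') : Prop :=
  IsComposition φt ∧
  (∃ (Q : RootedTree.{u}) (α : TreeHom P Q) (αt : TreeHom P' Q) (lab : Q → YoungDiagram),
    IsQuotient φ α ∧ IsTypeLabel φ α lab ∧
    IsQuotient φt αt ∧ IsTypeLabel φt αt (fun a => (lab a).transpose) ∧
    ∀ t : T, αt (φt t) = α (φ t)) ∧
  ZeroOneIntersection φ φt

/-! ### Common refinements -/

/-- `ρ`, together with `θ` and `τ`, is a common refinement of `(φ, ψ)`. -/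
structure IsCommonRefinement {T P M R : RootedTree.{u}} (φ : TreeHom T P) (ψ : TreeHom T M)
    (ρ : TreeHom T R) (θ : TreeHom R P) (τ : TreeHom R M) : Prop where
  composition : IsComposition ρ
  composition_left : IsComposition θ
  composition_right : IsComposition τ
  comm_left : ∀ t : T, θ (ρ t) = φ t
  comm_right : ∀ t : T, τ (ρ t) = ψ t

/-- The common refinements `ρ_v` of `(φ_v, ψ_v)` and `ρ_w` of `(φ_w, ψ_w)` are equivalent. It is
used when `θ (ρ v) = θ (ρ w)` and `τ (ρ v) = τ (ρ w)`, so that they have the same target trees. -/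
def RestrEquivalent {T P M R : RootedTree.{u}} (φ : TreeHom T P) (ψ : TreeHom T M)
    (ρ : TreeHom T R) (θ : TreeHom R P) (τ : TreeHom R M) (v w : T) : Prop :=
  ∃ (ζ : sub T v ≃o sub T w) (γ : sub R (ρ v) ≃o sub R (ρ w)),
    (∀ t : sub T v, φ (ζ t) = φ t) ∧ (∀ t : sub T v, ψ (ζ t) = ψ t) ∧
    (∀ t : sub T v, γ (ρ.restr v t) = ρ.restr w (ζ t)) ∧
    (∀ r : sub R (ρ v), θ (γ r) = θ r) ∧ (∀ r : sub R (ρ v), τ (γ r) = τ r)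

/-- The coarsest common refinement of `(φ, ψ)`: a common refinement with the coarseness condition.
For leaves the trees `T_v`, `T_w` are single vertices and the condition says that it is impossible
that both `θ a = θ b` and `τ a = τ b`. -/
structure IsCoarsestCommonRefinement {T P M R : RootedTree.{u}} (φ : TreeHom T P)
    (ψ : TreeHom T M) (ρ : TreeHom T R) (θ : TreeHom R P) (τ : TreeHom R M) : Prop
    extends IsCommonRefinement φ ψ ρ θ τ where
  coarse : ∀ a b : R, DistinctSiblings a b → θ a = θ b → τ a = τ b →
    ∀ v w : T, ρ v = a → ρ w = b → ¬ RestrEquivalent φ ψ ρ θ τ v w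

/-- The coarsest common refinement of `(φ, ψ)` is trivial: it is an isomorphism. -/
def TrivialCoarsestCommonRefinement {T P M : RootedTree.{u}} (φ : TreeHom T P)
    (ψ : TreeHom T M) : Prop :=
  ∃ (R : RootedTree.{u}) (ρ : TreeHom T R) (θ : TreeHom R P) (τ : TreeHom R M),
    IsCoarsestCommonRefinement φ ψ ρ θ τ ∧ ∃ e : T ≃o R, ∀ t : T, e t = ρ t

end TreeComp

/-! The core is the Gale–Ryser inequality. If a zero-one matrix has row sums `μ` and column sums
`ν`, then `μ` is dominated by the conjugate of `ν`, hence is lexicographically at most that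
conjugate; if the two are equal, the matrix is determined by its sums.

At a vertex `v` of `T` the children are the entries of a matrix whose rows are the values of `φ` and
whose columns are the values of `ψ`. Triviality of the coarsest common refinement
(`JointlySeparated`) does not make this matrix zero-one: it only forbids two children in the same
cell whose subtrees are isomorphic over both maps. Two statements are therefore proved together, by
induction on the height of `v` (`codeLE_and_codeRigid`): the labeling below `φ v` is at most the
conjugate labeling below `ψ v`, and when the two agree, the values `φ v` and `ψ v` determine the
pair of restrictions up to isomorphism. By rigidity one level down, children in the same cell whose
two labelings agree would be isomorphic, so the matrix restricted to such children is zero-one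
(`children_injective`). The inequality of Gale and Ryser then gives the comparison (`key_le_key`),
and its equality case gives rigidity (`exists_corresponding_child`).

The order on trees of partitions compares decreasing lists of children, whereas the induction
supplies inequalities child by child. `toColex_le_of_enumeration` bridges the two by looking at the
greatest key where the two sets differ. For this, labelings of bounded height are encoded in linear
orders `Code n`. On labelings in which siblings are distinguished by their subtrees
(`Labeling.Good`), equality of codes is isomorphism (`iso_of_code_eq`) and a strict inequality of
codes yields the order `GTAt` (`gtAt_of_code_lt`). Trees of partitions are of this kind
(`IsQuotient.good`), and every composition has one (`exists_treeOfPartitions`). -/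

namespace TreeComp

/-! ### Rooted trees -/

section Trees

variable {T T' : RootedTree.{u}}

theorem parent_unique {p q v : T} (hp : p ⋖ v) (hq : q ⋖ v) : p = q := by
  rw [← Order.pred_eq_of_covBy hp, ← Order.pred_eq_of_covBy hq]

theorem exists_child_le {v w : T} (h : v < w) : ∃ c, v ⋖ c ∧ c ≤ w := by
  obtain ⟨n, hn⟩ := h.le.exists_pred_iterate
  induction n generalizing w with
  | zero => simp only [Function.iterate_zero, id_eq] at hn; exact absurd hn h.ne'
  | succ n ih =>
    rw [Function.iterate_succ_apply] at hn
    have hm : ¬ IsMin w := fun hm => h.not_ge (hm h.le)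
    have hc := Order.pred_covBy_of_not_isMin hm
    rcases (Order.le_pred_of_lt h).eq_or_lt with h1 | h1
    · exact ⟨w, h1 ▸ hc, le_rfl⟩
    · obtain ⟨c, h2, h3⟩ := ih h1 hn
      exact ⟨c, h2, h3.trans hc.le⟩

theorem child_unique {v c c' w : T} (hc : v ⋖ c) (hc' : v ⋖ c') (h : c ≤ w) (h' : c' ≤ w) :
    c = c' := by
  rcases le_total_of_directed h' h with h1 | h1
  · exact h1.eq_of_not_lt fun h2 => hc'.2 hc.lt h2
  · exact (h1.eq_of_not_lt fun h2 => hc.2 hc'.lt h2).symm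

theorem exists_parent {w : T} (h : w ≠ ⊥) : ∃ v, v ⋖ w :=
  ⟨_, Order.pred_covBy_of_not_isMin (by simpa [isMin_iff_eq_bot] using h)⟩

theorem tree_induction {p : T → Prop} (hbot : p ⊥) (hstep : ∀ v w, v ⋖ w → p v → p w) (v : T) :
    p v := by
  obtain ⟨n, hn⟩ := (bot_le : ⊥ ≤ v).exists_pred_iterate
  induction n generalizing v with
  | zero => simp only [Function.iterate_zero, id_eq] at hn; exact hn ▸ hbot
  | succ n ih =>
    rw [Function.iterate_succ_apply] at hn
    by_cases h : v = ⊥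
    · exact h ▸ hbot
    · exact hstep _ _ (Order.pred_covBy_of_not_isMin (by simpa [isMin_iff_eq_bot] using h))
        (ih _ hn)

theorem isLeaf_or_isInternal (v : T) : IsLeaf v ∨ IsInternal v := by
  by_cases h : IsInternal v
  · exact Or.inr h
  · exact Or.inl fun w hw => h ⟨w, hw⟩

theorem IsLeaf.not_isInternal {v : T} (h : IsLeaf v) : ¬ IsInternal v := fun ⟨w, hw⟩ => h w hw

theorem not_isLeaf_iff {v : T} : ¬ IsLeaf v ↔ IsInternal v := by
  simp [IsLeaf, IsInternal]

theorem not_isInternal_iff {v : T} : ¬ IsInternal v ↔ IsLeaf v := by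
  simp [IsLeaf, IsInternal]

theorem IsLeaf.eq_of_le {v w : T} (h : IsLeaf v) (hw : v ≤ w) : w = v := by
  by_contra hne
  obtain ⟨c, hc, -⟩ := exists_child_le (lt_of_le_of_ne hw (Ne.symm hne))
  exact h c hc

/-! ### Isomorphisms of subtrees -/

theorem sub_bot (v : T) : (⊥ : sub T v) = ⟨v, le_rfl⟩ := rfl

theorem subIso_root {v : T} {w : T'} (ζ : sub T v ≃o sub T' w) : (ζ ⟨v, le_rfl⟩ : T') = w := by
  have := ζ.map_bot
  rw [sub_bot, sub_bot] at this
  rw [this]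

theorem subIso_covBy {v : T} {w : T'} (ζ : sub T v ≃o sub T' w) {a b : sub T v}
    (h : (a : T) ⋖ (b : T)) : (ζ a : T') ⋖ (ζ b : T') :=
  covBy_of_sub ((apply_covBy_apply_iff ζ).2 (sub_covBy h))

theorem subIso_lift {v : T} {w : T'} (ζ : sub T v ≃o sub T' w) {a : sub T v} {b : T'}
    (h : (ζ a : T') ⋖ b) : ∃ c : sub T v, (a : T) ⋖ (c : T) ∧ (ζ c : T') = b := by
  have hb : w ≤ b := (ζ a).2.trans h.le
  refine ⟨ζ.symm ⟨b, hb⟩, ?_, by rw [ζ.apply_symm_apply]⟩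
  have := subIso_covBy ζ.symm (a := ζ a) (b := ⟨b, hb⟩) h
  rwa [ζ.symm_apply_apply] at this

theorem subIso_isInternal {v : T} {w : T'} (ζ : sub T v ≃o sub T' w) (a : sub T v) :
    IsInternal (ζ a : T') ↔ IsInternal (a : T) := by
  constructor
  · rintro ⟨b, hb⟩
    obtain ⟨c, hc, -⟩ := subIso_lift ζ hb
    exact ⟨c, hc⟩
  · rintro ⟨b, hb⟩
    exact ⟨_, subIso_covBy ζ (a := a) (b := ⟨b, le_trans a.2 hb.le⟩) hb⟩

theorem subIso_isLeaf {v : T} {w : T'} (ζ : sub T v ≃o sub T' w) (a : sub T v) :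
    IsLeaf (ζ a : T') ↔ IsLeaf (a : T) := by
  rw [← not_isInternal_iff, subIso_isInternal, not_isInternal_iff]

/-- The restriction of an isomorphism of subtrees to a smaller subtree. -/
def subIsoRestrict {v : T} {w : T'} (ζ : sub T v ≃o sub T' w) (a : sub T v) :
    sub T (a : T) ≃o sub T' (ζ a : T') where
  toFun s := ⟨ζ ⟨s, le_trans a.2 s.2⟩, ζ.monotone s.2⟩
  invFun s := ⟨ζ.symm ⟨s, le_trans (ζ a).2 s.2⟩, by
    have := ζ.symm.monotone (a := ζ a) (b := ⟨s, le_trans (ζ a).2 s.2⟩) s.2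
    rw [ζ.symm_apply_apply] at this
    exact this⟩
  left_inv s := by
    refine Subtype.ext ?_
    exact congrArg (fun z : sub T v => (z : T)) (ζ.symm_apply_apply ⟨s, le_trans a.2 s.2⟩)
  right_inv s := by
    refine Subtype.ext ?_
    exact congrArg (fun z : sub T' w => (z : T')) (ζ.apply_symm_apply ⟨s, le_trans (ζ a).2 s.2⟩)
  map_rel_iff' {s t} := ζ.le_iff_le (x := ⟨s, le_trans a.2 s.2⟩) (y := ⟨t, le_trans a.2 t.2⟩)

/-- Change of the target root along an equality. -/
def subIsoCast {w w' : T} (h : w = w') : sub T w ≃o sub T w' where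
  toFun s := ⟨s, h ▸ s.2⟩
  invFun s := ⟨s, h ▸ s.2⟩
  left_inv _ := rfl
  right_inv _ := rfl
  map_rel_iff' := Iff.rfl

/-- Subtrees at leaves are isomorphic. -/
def leafIso {v : T} {w : T'} (hv : IsLeaf v) (hw : IsLeaf w) : sub T v ≃o sub T' w where
  toFun _ := ⟨w, le_rfl⟩
  invFun _ := ⟨v, le_rfl⟩
  left_inv s := Subtype.ext (hv.eq_of_le s.2).symm
  right_inv s := Subtype.ext (hw.eq_of_le s.2).symm
  map_rel_iff' {s t} := by
    have h1 : s = t := Subtype.ext ((hv.eq_of_le s.2).trans (hv.eq_of_le t.2).symm)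
    subst h1
    exact iff_of_true le_rfl le_rfl

/-- Isomorphisms between the subtrees at the children can be glued. -/
theorem exists_glued_iso {v : T} {w : T'} (e : {t // v ⋖ t} ≃ {t // w ⋖ t})
    (ζ : ∀ t : {t // v ⋖ t}, sub T t.1 ≃o sub T' (e t).1) :
    ∃ Z : sub T v ≃o sub T' w, ∀ (t : {t // v ⋖ t}) (s : T) (hs : t.1 ≤ s),
      (Z ⟨s, le_trans t.2.le hs⟩ : T') = ζ t ⟨s, hs⟩ := by
  classical
  have hch : ∀ s : sub T v, (s : T) ≠ v → ∃ t : {t // v ⋖ t}, t.1 ≤ s := fun s hs => by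
    obtain ⟨c, hc, hcs⟩ := exists_child_le (lt_of_le_of_ne s.2 (Ne.symm hs))
    exact ⟨⟨c, hc⟩, hcs⟩
  choose ch hch using hch
  have hle : ∀ t (s : sub T t.1), w < (ζ t s : T') := fun t s => (e t).2.lt.trans_le (ζ t s).2
  let F : sub T v → sub T' w := fun s =>
    if h : (s : T) = v then ⟨w, le_rfl⟩ else
      ⟨ζ (ch s h) ⟨s, hch s h⟩, (hle _ _).le⟩
  have F0 : ∀ s : sub T v, (s : T) = v → (F s : T') = w := fun s h => by simp [F, h]
  have F1 : ∀ (t : {t // v ⋖ t}) (s : T) (hs : t.1 ≤ s),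
      (F ⟨s, le_trans t.2.le hs⟩ : T') = ζ t ⟨s, hs⟩ := by
    intro t s hs
    have h : s ≠ v := (t.2.lt.trans_le hs).ne'
    have h2 : ch ⟨s, le_trans t.2.le hs⟩ h = t :=
      Subtype.ext (child_unique (ch ⟨s, le_trans t.2.le hs⟩ h).2 t.2 (hch _ _) hs)
    simp only [F, dif_neg h]
    -- The type of `ζ t'` depends on `t'`, so the chosen child is replaced by `t` through a general
    -- statement rather than by rewriting.
    have h3 : ∀ (t' : {t // v ⋖ t}) (h' : t'.1 ≤ s), t' = t →
        (ζ t' ⟨s, h'⟩ : T') = ζ t ⟨s, hs⟩ := by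
      rintro t' h' rfl
      rfl
    exact h3 _ _ h2
  have hrel : ∀ s s' : sub T v, F s ≤ F s' ↔ s ≤ s' := by
    intro s s'
    by_cases h : (s : T) = v
    · refine iff_of_true ?_ ?_
      · change (F s : T') ≤ F s'
        rw [F0 s h]; exact (F s').2
      · change (s : T) ≤ s'
        rw [h]; exact s'.2
    have e1 := F1 (ch s h) s (hch s h)
    by_cases h' : (s' : T) = v
    · refine iff_of_false (fun hl => ?_) (fun hl => ?_)
      · have hl : (F s : T') ≤ F s' := hl
        rw [F0 s' h', e1] at hl
        exact (hle _ _).not_ge hl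
      · have hl : (s : T) ≤ s' := hl
        rw [h'] at hl
        exact h (le_antisymm hl s.2)
    have e2 := F1 (ch s' h') s' (hch s' h')
    by_cases hc : ch s h = ch s' h'
    · change (F s : T') ≤ F s' ↔ _
      have e3 := F1 (ch s h) s' (hc ▸ hch s' h')
      rw [e1, e3]
      exact (ζ (ch s h)).le_iff_le
    · refine iff_of_false (fun hl => hc ?_) (fun hl => hc ?_)
      · have hl : (F s : T') ≤ F s' := hl
        rw [e1, e2] at hl
        exact e.injective (Subtype.ext (child_unique (e (ch s h)).2 (e (ch s' h')).2
          ((ζ (ch s h) ⟨s, hch s h⟩).2.trans hl) (ζ (ch s' h') ⟨s', hch s' h'⟩).2))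
      · exact Subtype.ext (child_unique (ch s h).2 (ch s' h').2 ((hch s h).trans hl) (hch s' h'))
  have hinj : Function.Injective F := fun s s' h =>
    le_antisymm ((hrel s s').1 h.le) ((hrel s' s).1 h.ge)
  have hsurj : Function.Surjective F := by
    intro r
    by_cases hr : (r : T') = w
    · exact ⟨⟨v, le_rfl⟩, Subtype.ext ((F0 _ rfl).trans hr.symm)⟩
    · obtain ⟨c, hc, hcr⟩ := exists_child_le (lt_of_le_of_ne r.2 (Ne.symm hr))
      obtain ⟨t, ht⟩ := e.surjective ⟨c, hc⟩
      have hcr' : (e t).1 ≤ r := by rw [ht]; exact hcr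
      refine ⟨⟨(ζ t).symm ⟨r, hcr'⟩, le_trans t.2.le ((ζ t).symm ⟨r, hcr'⟩).2⟩, Subtype.ext ?_⟩
      rw [F1 t _ ((ζ t).symm ⟨r, hcr'⟩).2]
      exact congrArg Subtype.val ((ζ t).apply_symm_apply ⟨r, hcr'⟩)
  exact ⟨⟨Equiv.ofBijective F ⟨hinj, hsurj⟩, fun {a b} => hrel a b⟩, F1⟩

/-- An isomorphism between the subtrees at two siblings extends to an automorphism. -/
theorem exists_swap_iso {x y : T} (hxy : DistinctSiblings x y) (ω : sub T x ≃o sub T y) :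
    ∃ g : T ≃o T, ∀ (t : T) (h : x ≤ t), g t = ω ⟨t, h⟩ := by
  classical
  obtain ⟨hne, p, hpx, hpy⟩ := hxy
  have hdis : ∀ t, x ≤ t → ¬ y ≤ t := fun t h1 h2 => hne (child_unique hpx hpy h1 h2)
  -- The two branches are exchanged by `ω` and its inverse. The map is an involution, so
  -- monotonicity alone makes it an order isomorphism.
  let F : T → T := fun t => if h : x ≤ t then ω ⟨t, h⟩ else if h : y ≤ t then ω.symm ⟨t, h⟩ else t
  have F1 : ∀ t (h : x ≤ t), F t = ω ⟨t, h⟩ := fun t h => by simp [F, h]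
  have F2 : ∀ t (h : y ≤ t), F t = ω.symm ⟨t, h⟩ := fun t h => by
    have : ¬ x ≤ t := fun h1 => hdis t h1 h
    simp [F, h, this]
  have F3 : ∀ t, ¬ x ≤ t → ¬ y ≤ t → F t = t := fun t h h' => by simp [F, h, h']
  -- An ancestor of a vertex of either branch that lies outside both branches is the common parent
  -- or one of its ancestors, so it stays below both branches.
  have hlow : ∀ s t : T, s ≤ t → (x ≤ t ∨ y ≤ t) → ¬ x ≤ s → ¬ y ≤ s → s ≤ p := by
    intro s t hst ht hx hy
    have key : ∀ z : T, p ⋖ z → z ≤ t → ¬ z ≤ s → s ≤ p := by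
      intro z hz hzt hzs
      rcases le_total_of_directed hzt hst with h | h
      · have h1 := Order.le_pred_of_lt (lt_of_le_of_ne h (fun h2 => hzs h2.ge))
        rwa [Order.pred_eq_of_covBy hz] at h1
      · exact absurd h hzs
    rcases ht with h | h
    · exact key x hpx h hx
    · exact key y hpy h hy
  have hinv : ∀ t, F (F t) = t := by
    intro t
    by_cases hx : x ≤ t
    · rw [F1 t hx, F2 _ (ω ⟨t, hx⟩).2]
      exact congrArg Subtype.val (ω.symm_apply_apply ⟨t, hx⟩)
    · by_cases hy : y ≤ t
      · rw [F2 t hy, F1 _ (ω.symm ⟨t, hy⟩).2]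
        exact congrArg Subtype.val (ω.apply_symm_apply ⟨t, hy⟩)
      · rw [F3 t hx hy, F3 t hx hy]
  have hmono : Monotone F := by
    intro s t hst
    by_cases hx : x ≤ s
    · rw [F1 s hx, F1 t (hx.trans hst)]
      exact ω.monotone (a := ⟨s, hx⟩) (b := ⟨t, hx.trans hst⟩) hst
    by_cases hy : y ≤ s
    · rw [F2 s hy, F2 t (hy.trans hst)]
      exact ω.symm.monotone (a := ⟨s, hy⟩) (b := ⟨t, hy.trans hst⟩) hst
    rw [F3 s hx hy]
    by_cases hx' : x ≤ t
    · rw [F1 t hx']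
      exact (hlow s t hst (Or.inl hx') hx hy).trans (hpy.le.trans (ω ⟨t, hx'⟩).2)
    by_cases hy' : y ≤ t
    · rw [F2 t hy']
      exact (hlow s t hst (Or.inr hy') hx hy).trans (hpx.le.trans (ω.symm ⟨t, hy'⟩).2)
    rw [F3 t hx' hy']
    exact hst
  refine ⟨⟨⟨F, F, hinv, hinv⟩, fun {s t} => ⟨fun h => ?_, fun h => hmono h⟩⟩, F1⟩
  have := hmono h
  change F (F s) ≤ F (F t) at this
  rwa [hinv, hinv] at this

end Trees

/-! ### Tree compositions -/

section Compositions

variable {T T' P Q : RootedTree.{u}}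

/-- The restriction of an isomorphism of trees to a subtree. -/
def isoRestrict (g : T ≃o T') (v : T) : sub T v ≃o sub T' (g v) where
  toFun s := ⟨g s, g.monotone s.2⟩
  invFun s := ⟨g.symm s, by
    have := g.symm.monotone (a := g v) (b := s) s.2
    rwa [g.symm_apply_apply] at this⟩
  left_inv s := Subtype.ext (g.symm_apply_apply (s : T))
  right_inv s := Subtype.ext (g.apply_symm_apply (s : T'))
  map_rel_iff' {s t} := g.le_iff_le (x := (s : T)) (y := t)

theorem TreeHom.eq_bot_of_map_eq_bot (φ : TreeHom T P) {v : T} (h : φ v = ⊥) : v = ⊥ := by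
  by_contra hv
  obtain ⟨p, hp⟩ := exists_parent hv
  have := (φ.map_covBy _ _ hp).lt
  rw [h] at this
  exact not_lt_bot this

theorem TreeHom.isInternal_map (φ : TreeHom T P) {v : T} (h : IsInternal v) :
    IsInternal (φ v) := by
  obtain ⟨w, hw⟩ := h
  exact ⟨_, φ.map_covBy _ _ hw⟩

theorem IsComposition.isInternal_iff {φ : TreeHom T P} (hφ : IsComposition φ) (v : T) :
    IsInternal (φ v) ↔ IsInternal v := by
  refine ⟨fun h => ?_, φ.isInternal_map⟩
  rw [← not_isLeaf_iff] at h ⊢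
  exact fun h' => h (hφ.leaf v h')

theorem IsComposition.isLeaf_iff {φ : TreeHom T P} (hφ : IsComposition φ) (v : T) :
    IsLeaf (φ v) ↔ IsLeaf v := by
  rw [← not_isInternal_iff, hφ.isInternal_iff, not_isInternal_iff]

/-- Subtrees at vertices with the same image are isomorphic compatibly with the composition. -/
theorem IsComposition.exists_strict_iso {φ : TreeHom T P} (hφ : IsComposition φ) :
    ∀ v w : T, φ v = φ w → ∃ ζ : sub T v ≃o sub T w, ∀ t : sub T v, φ (ζ t) = φ t := by
  intro v
  induction v using tree_induction with
  | hbot =>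
    intro w h
    rw [φ.map_bot] at h
    obtain rfl := φ.eq_bot_of_map_eq_bot h.symm
    exact ⟨OrderIso.refl _, fun t => rfl⟩
  | hstep p v hpv ih =>
    intro w h
    have hv : v ≠ ⊥ := hpv.lt.ne_bot
    obtain ⟨q, hqw⟩ := exists_parent (w := w) fun hw => hv (φ.eq_bot_of_map_eq_bot (by
      rw [h, hw, φ.map_bot]))
    have hpq : φ p = φ q := parent_unique (φ.map_covBy _ _ hpv) (h ▸ φ.map_covBy _ _ hqw)
    rcases isLeaf_or_isInternal v with hl | hi
    · have hlw : IsLeaf w := by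
        rw [← hφ.isLeaf_iff, ← h]; exact hφ.leaf v hl
      refine ⟨leafIso hl hlw, fun t => ?_⟩
      rw [hl.eq_of_le t.2, h]
      rfl
    -- The isomorphism at the parents sends `v` to a child of `q` in the fibre of `w`; if this child
    -- is not `w`, regularity moves it there.
    obtain ⟨ζ, hζ⟩ := ih q hpq
    let a : sub T p := ⟨v, hpv.le⟩
    have hqu : q ⋖ (ζ a : T) := by
      have h1 := subIso_covBy ζ (a := ⟨p, le_rfl⟩) (b := a) hpv
      rwa [subIso_root] at h1
    have hu : φ (ζ a) = φ v := hζ a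
    by_cases hne : (ζ a : T) = w
    · refine ⟨(subIsoRestrict ζ a).trans (subIsoCast hne), fun t => ?_⟩
      exact hζ ⟨t, le_trans a.2 t.2⟩
    · obtain ⟨g, hg1, hg2⟩ := hφ.regular (ζ a) w ⟨hne, q, hqu, hqw⟩
        ((subIso_isInternal ζ a).2 hi) (by
          rw [← hφ.isInternal_iff, ← h, hφ.isInternal_iff]; exact hi) (hu.trans h)
      refine ⟨((subIsoRestrict ζ a).trans (isoRestrict g _)).trans (subIsoCast hg1), fun t => ?_⟩
      exact (hg2 _ (subIsoRestrict ζ a t).2).symm.trans (hζ ⟨t, le_trans a.2 t.2⟩)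

/-- Surjectivity gives a preimage of `y` somewhere in `T`. Its parent has the same image as `v`, so
a strict isomorphism carries the preimage to a child of `v`. -/
theorem IsComposition.exists_child {φ : TreeHom T P} (hφ : IsComposition φ) {v : T} {y : P}
    (h : φ v ⋖ y) : ∃ w, v ⋖ w ∧ φ w = y := by
  obtain ⟨w, rfl⟩ := hφ.surjective y
  obtain ⟨q, hq⟩ := exists_parent (w := w) fun hw => by
    rw [hw, φ.map_bot] at h
    exact not_lt_bot h.lt
  obtain ⟨ζ, hζ⟩ := hφ.exists_strict_iso q v (parent_unique (φ.map_covBy _ _ hq) h)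
  refine ⟨ζ ⟨w, hq.le⟩, ?_, hζ _⟩
  have h1 := subIso_covBy ζ (a := ⟨q, le_rfl⟩) (b := ⟨w, hq.le⟩) hq
  rwa [subIso_root] at h1

/-- An isomorphism of subtrees induces a bijection between the children of the roots. -/
noncomputable def childEquiv {v : T} {w : T'} (ζ : sub T v ≃o sub T' w) :
    {t // v ⋖ t} ≃ {t // w ⋖ t} where
  toFun t := ⟨ζ ⟨t.1, t.2.le⟩, by
    have h1 := subIso_covBy ζ (a := ⟨v, le_rfl⟩) (b := ⟨t.1, t.2.le⟩) t.2
    rwa [subIso_root] at h1⟩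
  invFun t := ⟨ζ.symm ⟨t.1, t.2.le⟩, by
    have h1 := subIso_covBy ζ.symm (a := ⟨w, le_rfl⟩) (b := ⟨t.1, t.2.le⟩) t.2
    rwa [subIso_root] at h1⟩
  left_inv t := by
    refine Subtype.ext ?_
    exact congrArg (fun z : sub T v => (z : T)) (ζ.symm_apply_apply ⟨t.1, t.2.le⟩)
  right_inv t := by
    refine Subtype.ext ?_
    exact congrArg (fun z : sub T' w => (z : T')) (ζ.apply_symm_apply ⟨t.1, t.2.le⟩)

theorem childEquiv_apply {v : T} {w : T'} (ζ : sub T v ≃o sub T' w) (t : {t // v ⋖ t}) :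
    (childEquiv ζ t : T') = ζ ⟨t.1, t.2.le⟩ := rfl

theorem card_children_congr {v : T} {w : T'} (e : {t // v ⋖ t} ≃ {t // w ⋖ t}) {p : T → Prop}
    {q : T' → Prop} (h : ∀ t, p t.1 ↔ q (e t).1) :
    Nat.card {t : T // v ⋖ t ∧ p t} = Nat.card {t : T' // w ⋖ t ∧ q t} := by
  refine Nat.card_congr ?_
  exact (Equiv.subtypeSubtypeEquivSubtypeInter (fun t => v ⋖ t) p).symm.trans
    ((e.subtypeEquiv h).trans (Equiv.subtypeSubtypeEquivSubtypeInter (fun t => w ⋖ t) q))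

theorem IsComposition.card_children_eq {φ : TreeHom T P} (hφ : IsComposition φ) {v w : T}
    (h : φ v = φ w) (y : P) :
    Nat.card {t : T // v ⋖ t ∧ φ t = y} = Nat.card {t : T // w ⋖ t ∧ φ t = y} := by
  obtain ⟨ζ, hζ⟩ := hφ.exists_strict_iso v w h
  refine card_children_congr (childEquiv ζ) fun t => ?_
  rw [childEquiv_apply, hζ]

/-! ### Equivalence of compositions -/

theorem Equivalent.refl (φ : TreeHom T P) : Equivalent φ φ :=
  ⟨OrderIso.refl _, OrderIso.refl _, fun _ => rfl⟩

theorem Equivalent.symm {φ : TreeHom T P} {ψ : TreeHom T' Q} (h : Equivalent φ ψ) :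
    Equivalent ψ φ := by
  obtain ⟨τ, ω, h⟩ := h
  refine ⟨τ.symm, ω.symm, fun t => ?_⟩
  rw [← τ.apply_symm_apply t, ← h, ω.symm_apply_apply, τ.symm_apply_apply]

theorem Equivalent.trans {T₁ P₁ : RootedTree.{u}} {φ : TreeHom T P} {ψ : TreeHom T' Q}
    {χ : TreeHom T₁ P₁} (h : Equivalent φ ψ) (h' : Equivalent ψ χ) : Equivalent φ χ := by
  obtain ⟨τ, ω, h⟩ := h
  obtain ⟨τ', ω', h'⟩ := h'
  exact ⟨τ.trans τ', ω.trans ω', fun t => by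
    rw [OrderIso.trans_apply, OrderIso.trans_apply, h, h']⟩

theorem IsComposition.equivalent_of_eq {φ : TreeHom T P} (hφ : IsComposition φ) {v w : T}
    (h : φ v = φ w) : Equivalent (φ.restr v) (φ.restr w) := by
  obtain ⟨ζ, hζ⟩ := hφ.exists_strict_iso v w h
  exact ⟨ζ, subIsoCast h, fun t => Subtype.ext (hζ t).symm⟩

/-- One isomorphism of the target subtrees serves all the vertices in the fibres. -/
theorem IsComposition.exists_block_iso {φ : TreeHom T P} (hφ : IsComposition φ) {v w : T}
    (h : Equivalent (φ.restr v) (φ.restr w)) {y z : P} (hy : φ v = y) (hz : φ w = z) :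
    ∃ ω : sub P y ≃o sub P z, ∀ t t' : T, φ t = y → φ t' = z →
      ∃ τ : sub T t ≃o sub T t', ∀ (s : sub T t) (hs : y ≤ φ s),
        (ω ⟨φ s, hs⟩ : P) = φ (τ s) := by
  subst hy hz
  obtain ⟨τ, ω, h⟩ := h
  refine ⟨ω, fun t t' ht ht' => ?_⟩
  obtain ⟨ζ, hζ⟩ := hφ.exists_strict_iso t v ht
  obtain ⟨ζ', hζ'⟩ := hφ.exists_strict_iso w t' ht'.symm
  refine ⟨(ζ.trans τ).trans ζ', fun s hs => ?_⟩
  have h1 := congrArg (fun z : sub P (φ w) => (z : P)) (h (ζ s))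
  have h2 : (⟨φ s, hs⟩ : sub P (φ v)) = φ.restr v (ζ s) := Subtype.ext (hζ s).symm
  rw [h2]
  exact h1.trans (hζ' _).symm

/-- Bijections between corresponding fibres assemble to a bijection of the total sets; `R` carries
along any extra compatibility. -/
theorem exists_equiv_of_fibers {X X' C C' : Type*} {p : X → Prop} {p' : X' → Prop}
    {q : C → Prop} {q' : C' → Prop} (f : X → C) (f' : X' → C') (hf : ∀ x, p x → q (f x))
    (hf' : ∀ x, p' x → q' (f' x)) (γ : {c // q c} ≃ {c // q' c}) (R : X → X' → Prop)
    (h : ∀ c : {c // q c}, ∃ E : {x // p x ∧ f x = c} ≃ {x // p' x ∧ f' x = γ c},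
      ∀ x, R x.1 (E x).1) :
    ∃ E : {x // p x} ≃ {x // p' x}, ∀ x, f' (E x) = γ ⟨f x, hf _ x.2⟩ ∧ R x (E x) := by
  choose E hE using h
  let F : {x // p x} → {x // p' x} := fun x =>
    ⟨E ⟨f x, hf _ x.2⟩ ⟨x, x.2, rfl⟩, (E ⟨f x, hf _ x.2⟩ ⟨x, x.2, rfl⟩).2.1⟩
  have hF : ∀ x, f' (F x) = γ ⟨f x, hf _ x.2⟩ := fun x =>
    (E ⟨f x, hf _ x.2⟩ ⟨x, x.2, rfl⟩).2.2
  have hF' : ∀ (c : {c // q c}) (x : {x // p x}) (hx : f x = c),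
      (F x).1 = E c ⟨x, x.2, hx⟩ := by
    rintro ⟨c, hc⟩ x hx
    dsimp only at hx
    subst hx
    rfl
  refine ⟨Equiv.ofBijective F ⟨fun x x' hxx' => ?_, fun x' => ?_⟩, fun x => ⟨hF x, hE _ ⟨x, x.2, rfl⟩⟩⟩
  · have h1 : f x = f x' := by
      have h2 := hF x
      rw [hxx', hF x'] at h2
      exact (congrArg Subtype.val (γ.injective (Subtype.ext h2))).symm
    have h3 := hF' ⟨f x, hf _ x.2⟩ x rfl
    rw [hxx', hF' ⟨f x, hf _ x.2⟩ x' h1.symm] at h3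
    have h4 := (E ⟨f x, hf _ x.2⟩).injective (Subtype.ext h3)
    exact Subtype.ext (congrArg Subtype.val h4).symm
  · let c := γ.symm ⟨f' x', hf' _ x'.2⟩
    let x := (E c).symm ⟨x', x'.2, by simp [c]⟩
    refine ⟨⟨x, x.2.1⟩, Subtype.ext ?_⟩
    rw [hF' c _ x.2.2]
    simp [x]

/-! ### The labeling determines the composition -/

/-- Siblings with the same partitional labeling are equal. -/
def Labeling.Good (Λ : Labeling.{u}) : Prop :=
  ∀ a c c' : Λ.tree, a ⋖ c → a ⋖ c' →
    ((IsLeaf c ∧ IsLeaf c') ∨ (IsInternal c ∧ IsInternal c' ∧ (Λ.sub c).Iso (Λ.sub c'))) → c = c'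

theorem IsQuotient.exists_child {φ : TreeHom T P} {α : TreeHom P Q} (hφ : IsComposition φ)
    (hα : IsQuotient φ α) {v : T} {b : Q} (h : α (φ v) ⋖ b) : ∃ w, v ⋖ w ∧ α (φ w) = b := by
  obtain ⟨y, hy, rfl⟩ := hα.composition.exists_child h
  obtain ⟨w, hw, rfl⟩ := hφ.exists_child hy
  exact ⟨w, hw, rfl⟩

theorem Labeling.sub_iso_sub_iff {Λ Ξ : Labeling.{u}} {a : Λ.tree} {b : Ξ.tree} :
    (Λ.sub a).Iso (Ξ.sub b) ↔ ∃ γ : TreeComp.sub Λ.tree a ≃o TreeComp.sub Ξ.tree b,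
      ∀ c (hc : a < c), Λ.label c = Ξ.label (γ ⟨c, hc.le⟩) := by
  constructor
  · rintro ⟨γ, hγ⟩
    refine ⟨γ, fun c hc => hγ ⟨c, hc.le⟩ fun h => hc.ne ?_⟩
    exact (congrArg (fun z : TreeComp.sub Λ.tree a => (z : Λ.tree)) h).symm
  · rintro ⟨γ, hγ⟩
    have h : ∀ c : TreeComp.sub Λ.tree a, c ≠ ⊥ → Λ.label c = Ξ.label (γ c) := fun c hc =>
      hγ c (lt_of_le_of_ne c.2 fun h => hc (Subtype.ext h.symm))
    exact ⟨γ, h⟩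

theorem Labeling.iso_sub_of_iso {Λ Ξ : Labeling.{u}} {a : Λ.tree} {b : Ξ.tree}
    (γ : TreeComp.sub Λ.tree a ≃o TreeComp.sub Ξ.tree b)
    (hγ : ∀ c (hc : a < c), Λ.label c = Ξ.label (γ ⟨c, hc.le⟩))
    (c : TreeComp.sub Λ.tree a) : (Λ.sub (c : Λ.tree)).Iso (Ξ.sub (γ c : Ξ.tree)) :=
  Labeling.sub_iso_sub_iff.2 ⟨subIsoRestrict γ c, fun s hs => hγ s (lt_of_le_of_lt c.2 hs)⟩

/-- Equal partitions have equal parts, so the children of `φ v` and `φ w` can be matched with equal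
fibre sizes, and then the children of `v` and `w` can be matched over them. The inductive hypothesis
gives equivalences of the subtrees, which are glued. -/
theorem Equivalent.of_labeling_iso [Finite T] {Λ : Labeling.{u}} {φ : TreeHom T P}
    {α : TreeHom P Λ.tree} (hφ : IsComposition φ) (hΛ : IsTypeLabel φ α Λ.label) (v w : T)
    (h : (Λ.sub (α (φ v))).Iso (Λ.sub (α (φ w)))) :
    Equivalent (φ.restr v) (φ.restr w) := by
  induction v using WellFoundedGT.induction generalizing w with
  | ind v ih =>
  obtain ⟨γ, hγ⟩ := Labeling.sub_iso_sub_iff.1 h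
  have hP : Finite P := Finite.of_surjective _ hφ.surjective
  obtain ⟨E, hE⟩ := exists_equiv_of_fibers (p := fun y => φ v ⋖ y) (p' := fun y => φ w ⋖ y)
    α α (fun y hy => α.map_covBy _ _ hy) (fun y hy => α.map_covBy _ _ hy) (childEquiv γ)
    (fun y z => Nat.card {t : T // v ⋖ t ∧ φ t = y} = Nat.card {t : T // w ⋖ t ∧ φ t = z}) (by
      intro c
      obtain ⟨e, he⟩ := hΛ v c c.2
      obtain ⟨e', he'⟩ := hΛ w (childEquiv γ c) (childEquiv γ c).2
      have hl : Λ.label c = Λ.label (childEquiv γ c) := hγ c c.2.lt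
      -- The two enumerations are indexed by types depending on the label; identifying the labels
      -- lets them be composed.
      generalize Λ.label (childEquiv γ c) = μ at e' he' hl
      subst hl
      refine ⟨e.symm.trans e', fun y => ?_⟩
      obtain ⟨i, rfl⟩ := e.surjective y
      rw [← he, Equiv.trans_apply, Equiv.symm_apply_apply, ← he'])
  obtain ⟨e, he⟩ := exists_equiv_of_fibers (p := fun t => v ⋖ t) (p' := fun t => w ⋖ t)
    φ φ (fun t ht => φ.map_covBy _ _ ht) (fun t ht => φ.map_covBy _ _ ht) E (fun _ _ => True) (by
      intro y
      obtain ⟨f⟩ := (Finite.card_eq).1 (hE y).2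
      exact ⟨f, fun _ => trivial⟩)
  -- The isomorphism of target subtrees is fixed once for each child of `φ v`; otherwise children of
  -- `v` in the same fibre could impose incompatible choices.
  have hblock : ∀ y : {y // φ v ⋖ y}, ∃ ω : sub P y.1 ≃o sub P (E y).1,
      ∀ t t' : T, φ t = y.1 → φ t' = (E y).1 → ∃ τ : sub T t ≃o sub T t',
        ∀ (s : sub T t) (hs : y.1 ≤ φ s), (ω ⟨φ s, hs⟩ : P) = φ (τ s) := by
    intro y
    obtain ⟨t, ht, hty⟩ := hφ.exists_child y.2
    obtain ⟨t', ht', hty'⟩ := hφ.exists_child (E y).2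
    refine hφ.exists_block_iso (ih t ht.lt t' ?_) hty hty'
    have h1 := Labeling.iso_sub_of_iso γ hγ ⟨α (φ t), (α.map_covBy _ _ (φ.map_covBy _ _ ht)).le⟩
    have h2 := (hE y).1
    rw [← hty', childEquiv_apply] at h2
    rw [h2]
    simp only [← hty]
    exact h1
  choose ω hω using hblock
  have hτ : ∀ t : {t // v ⋖ t}, ∃ τ : sub T t.1 ≃o sub T (e t).1, ∀ (s : sub T t.1) hs,
      (ω ⟨φ t, φ.map_covBy _ _ t.2⟩ ⟨φ s, hs⟩ : P) = φ (τ s) := fun t =>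
    hω ⟨φ t, φ.map_covBy _ _ t.2⟩ t (e t) rfl (he t).1
  choose τ hτ using hτ
  obtain ⟨Z, hZ⟩ := exists_glued_iso e τ
  obtain ⟨W, hW⟩ := exists_glued_iso E ω
  refine ⟨Z, W, fun s => Subtype.ext ?_⟩
  change (W ⟨φ s, φ.monotone s.2⟩ : P) = φ (Z s)
  by_cases hs : (s : T) = v
  · obtain rfl : s = ⟨v, le_rfl⟩ := Subtype.ext hs
    rw [subIso_root Z]
    exact subIso_root W
  · obtain ⟨c, hc, hcs⟩ := exists_child_le (lt_of_le_of_ne s.2 (Ne.symm hs))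
    have h1 := hZ ⟨c, hc⟩ s hcs
    have h2 := hW ⟨φ c, φ.map_covBy _ _ hc⟩ (φ s) (φ.monotone hcs)
    rw [h2, h1]
    exact hτ ⟨c, hc⟩ ⟨s, hcs⟩ _

/-- Isomorphic labelings below two siblings would make the corresponding restrictions of `φ`
equivalent, which the quotient forbids for distinct internal siblings; leaf children are unique by
definition. -/
theorem IsQuotient.good [Finite T] {Λ : Labeling.{u}} {φ : TreeHom T P}
    {α : TreeHom P Λ.tree} (hφ : IsComposition φ) (hα : IsQuotient φ α)
    (hΛ : IsTypeLabel φ α Λ.label) : Λ.Good := by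
  intro a c c' hc hc' h
  obtain ⟨x, rfl⟩ := hα.composition.surjective a
  obtain ⟨v, rfl⟩ := hφ.surjective x
  obtain ⟨t, ht, rfl⟩ := hα.exists_child hφ hc
  obtain ⟨t', ht', rfl⟩ := hα.exists_child hφ hc'
  rcases h with ⟨h1, h2⟩ | ⟨h1, h2, h3⟩
  · exact ((hα.leaves _ _ (φ.map_covBy _ _ ht) ((hα.composition.isLeaf_iff _).1 h1)).2 _ hc'
      h2).symm
  · by_contra hne
    exact hα.not_equivalent _ _ ⟨hne, _, hc, hc'⟩ h1 h2 t t' ⟨fun h => hne (h ▸ rfl), v, ht, ht'⟩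
      rfl rfl (Equivalent.of_labeling_iso hφ hΛ t t' h3)

end Compositions

/-! ### Trees of paths -/

section PathTree

variable {K : Type u}

/-- The tree whose vertices are the lists in a set closed under tails; the children of a list are
obtained by adding a head. -/
noncomputable def pathTree (S : Set (List K)) (h0 : [] ∈ S) (hS : ∀ k l, k :: l ∈ S → l ∈ S) :
    RootedTree.{u} :=
  have htail : ∀ l ∈ S, l.tail ∈ S := fun l hl => by
    cases l with
    | nil => exact hl
    | cons k l => exact hS k l hl
  -- The order is the suffix order, so the infimum is the longest common suffix.
  have hinf : ∀ a b : {l // l ∈ S}, ∃ c : {l // l ∈ S}, c.1 <:+ a.1 ∧ c.1 <:+ b.1 ∧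
      ∀ d : {l // l ∈ S}, d.1 <:+ a.1 → d.1 <:+ b.1 → d.1 <:+ c.1 := fun ⟨a, ha⟩ b => by
    induction a with
    | nil => exact ⟨⟨[], h0⟩, List.nil_suffix, List.nil_suffix, fun d h _ => h⟩
    | cons k l ih =>
      by_cases h : (k :: l) <:+ b.1
      · exact ⟨⟨k :: l, ha⟩, List.suffix_rfl, h, fun d h _ => h⟩
      · obtain ⟨c, h1, h2, h3⟩ := ih (hS k l ha)
        refine ⟨c, h1.trans (List.suffix_cons k l), h2, fun d hd hd' => h3 d ?_ hd'⟩
        rcases List.suffix_cons_iff.1 hd with h4 | h4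
        · exact absurd (h4 ▸ hd') h
        · exact h4
  let po : PartialOrder {l // l ∈ S} :=
    { le := fun a b => a.1 <:+ b.1
      le_refl := fun _ => List.suffix_rfl
      le_trans := fun _ _ _ h h' => h.trans h'
      le_antisymm := fun _ _ h h' => Subtype.ext (h.eq_of_length_le h'.length_le) }
  let sl : SemilatticeInf {l // l ∈ S} :=
    { po with
      inf := fun a b => (hinf a b).choose
      inf_le_left := fun a b => (hinf a b).choose_spec.1
      inf_le_right := fun a b => (hinf a b).choose_spec.2.1
      le_inf := fun a b c h h' => (hinf b c).choose_spec.2.2 a h h' }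
  let ob : OrderBot {l // l ∈ S} :=
    { bot := ⟨[], h0⟩
      bot_le := fun _ => List.nil_suffix }
  let pr : PredOrder {l // l ∈ S} :=
    { pred := fun a => ⟨a.1.tail, htail _ a.2⟩
      pred_le := fun a => List.tail_suffix a.1
      min_of_le_pred := fun {a} h b hb => by
        obtain ⟨a, ha⟩ := a
        cases a with
        | nil => exact List.nil_suffix
        | cons k l =>
          have h1 := List.IsSuffix.length_le h
          simp at h1
      le_pred_of_lt := fun {a b} h => by
        obtain ⟨b, hb⟩ := b
        have h1 : a.1 <:+ b := h.1
        have h2 : ¬ b <:+ a.1 := h.2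
        change a.1 <:+ b.tail
        cases b with
        | nil => exact absurd List.nil_suffix h2
        | cons k l =>
          rcases List.suffix_cons_iff.1 h1 with h4 | h4
          · exact absurd (h4 ▸ List.suffix_rfl) h2
          · exact h4 }
  { α := {l // l ∈ S}
    semilatticeInf := sl
    orderBot := ob
    predOrder := pr
    isPredArchimedean :=
      { exists_pred_iterate_of_le := fun {a b} h => by
          obtain ⟨b, hb⟩ := b
          induction b with
          | nil => exact ⟨0, Subtype.ext (List.suffix_nil.1 h).symm⟩
          | cons k l ih =>
            rcases List.suffix_cons_iff.1 h with h4 | h4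
            · exact ⟨0, Subtype.ext h4.symm⟩
            · obtain ⟨n, hn⟩ := ih (hS k l hb) h4
              exact ⟨n + 1, hn⟩ } }

variable {S : Set (List K)} {h0 : [] ∈ S} {hS : ∀ k l, k :: l ∈ S → l ∈ S}

theorem pathTree_covBy_iff {a b : pathTree S h0 hS} :
    a ⋖ b ↔ ∃ k, (b : {l // l ∈ S}).1 = k :: (a : {l // l ∈ S}).1 := by
  constructor
  · intro h
    have h1 := Order.pred_eq_of_covBy h
    obtain ⟨b, hb⟩ := b
    cases b with
    | nil =>
      have h2 : a < (⊥ : pathTree S h0 hS) := h.lt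
      exact absurd h2 not_lt_bot
    | cons k l =>
      subst h1
      exact ⟨k, rfl⟩
  · rintro ⟨k, hk⟩
    obtain ⟨b, hb⟩ := b
    dsimp only at hk
    subst hk
    have h1 : Order.pred (α := pathTree S h0 hS) ⟨k :: a.1, hb⟩ = a := rfl
    conv_lhs => rw [← h1]
    refine Order.pred_covBy_of_not_isMin fun hm => ?_
    have h2 := hm (bot_le : ⊥ ≤ _)
    have h3 : (k :: a.1) <:+ [] := h2
    simp at h3

/-- The recursion towards the root records the colours met on the way. It is run with a bound on the
number of steps; two sufficient bounds give the same list because the predecessor of the root is the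
root. -/
theorem exists_path {P : RootedTree.{u}} (c : P → K) :
    ∃ f : P → List K, f ⊥ = [] ∧ ∀ x y, x ⋖ y → f y = c y :: f x := by
  have hex : ∀ n : ℕ, ∃ f : P → List K, f ⊥ = [] ∧
      ∀ x y, x ⋖ y → Order.pred^[n] y = ⊥ → f y = c y :: f x := by
    intro n
    induction n with
    | zero => exact ⟨fun _ => [], rfl, fun x y h h' => absurd h (by
        simp only [Function.iterate_zero, id_eq] at h'; rw [h']; exact fun h => not_lt_bot h.lt)⟩
    | succ n ih =>
      classical
      obtain ⟨f, h1, h2⟩ := ih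
      refine ⟨fun y => if y = ⊥ then [] else c y :: f (Order.pred y), by simp, fun x y h h' => ?_⟩
      rw [Function.iterate_succ_apply, Order.pred_eq_of_covBy h] at h'
      simp only [h.lt.ne_bot, if_false, Order.pred_eq_of_covBy h]
      split_ifs with hx
      · rw [hx, h1]
      · obtain ⟨p, hp⟩ := exists_parent hx
        rw [h2 p x hp h', Order.pred_eq_of_covBy hp]
  choose F hF0 hF using hex
  have hind : ∀ y : P, ∀ n m, Order.pred^[n] y = ⊥ → Order.pred^[m] y = ⊥ → F n y = F m y := by
    intro y
    induction y using tree_induction with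
    | hbot => intro n m _ _; rw [hF0, hF0]
    | hstep x y hxy ih =>
      intro n m hn hm
      rw [hF n x y hxy hn, hF m x y hxy hm]
      have key : ∀ k, Order.pred^[k] y = ⊥ → Order.pred^[k] x = ⊥ := fun k hk => by
        rw [← Order.pred_eq_of_covBy hxy, ← Function.iterate_succ_apply,
          Function.iterate_succ_apply', hk, Order.pred_bot]
      rw [ih n m (key n hn) (key m hm)]
  choose lev hlev using fun y : P => (bot_le : ⊥ ≤ y).exists_pred_iterate
  refine ⟨fun y => F (lev y) y, hF0 _, fun x y hxy => ?_⟩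
  change F (lev y) y = c y :: F (lev x) x
  rw [hF _ x y hxy (hlev y)]
  refine congrArg _ (hind x _ _ ?_ (hlev x))
  rw [← Order.pred_eq_of_covBy hxy, ← Function.iterate_succ_apply,
          Function.iterate_succ_apply', hlev, Order.pred_bot]

end PathTree

/-! ### Existence of the quotient and of the tree of partitions -/

section Quotient

variable {T P : RootedTree.{u}}

theorem IsComposition.exists_le_lift {φ : TreeHom T P} (hφ : IsComposition φ) {v : T} (y : P)
    (h : φ v ≤ y) : ∃ s, v ≤ s ∧ φ s = y := by
  induction y using tree_induction with
  | hbot => exact ⟨v, le_rfl, le_bot_iff.1 h⟩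
  | hstep x y hxy ih =>
    rcases h.eq_or_lt with h1 | h1
    · exact ⟨v, le_rfl, h1⟩
    · have h2 := Order.le_pred_of_lt h1
      rw [Order.pred_eq_of_covBy hxy] at h2
      obtain ⟨s, hs, rfl⟩ := ih h2
      obtain ⟨t, ht, rfl⟩ := hφ.exists_child hxy
      exact ⟨t, hs.trans ht.le, rfl⟩

/-- Vertices of `P` are coloured by the equivalence class of the restriction at any preimage; the
choice does not matter by `equivalent_of_eq`. -/
theorem IsComposition.exists_type {φ : TreeHom T P} (hφ : IsComposition φ) :
    ∃ (K : Type u) (c : P → K), ∀ v w : T,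
      c (φ v) = c (φ w) ↔ Equivalent (φ.restr v) (φ.restr w) := by
  let s : Setoid T := ⟨fun v w => Equivalent (φ.restr v) (φ.restr w),
    fun _ => .refl _, fun h => h.symm, fun h h' => h.trans h'⟩
  choose g hg using hφ.surjective
  refine ⟨Quotient s, fun y => ⟦g y⟧, fun v w => Quotient.eq.trans ⟨fun h => ?_, fun h => ?_⟩⟩
  · exact ((hφ.equivalent_of_eq (hg (φ v))).symm.trans h).trans (hφ.equivalent_of_eq (hg (φ w)))
  · exact ((hφ.equivalent_of_eq (hg (φ v))).trans h).trans
      (hφ.equivalent_of_eq (hg (φ w))).symm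

/-- The heads of equal paths give an equivalence of the restrictions. This restricts further to
every descendant, so colours are preserved, and the paths below agree by induction. -/
theorem exists_path_preserving {φ : TreeHom T P} (hφ : IsComposition φ) {K : Type u} {c : P → K}
    (hc : ∀ v w : T, c (φ v) = c (φ w) ↔ Equivalent (φ.restr v) (φ.restr w))
    {f : P → List K} (hf0 : f ⊥ = []) (hf : ∀ x y, x ⋖ y → f y = c y :: f x) {v w : T}
    (h : f (φ v) = f (φ w)) :
    ∃ (τ : sub T v ≃o sub T w) (ω : sub P (φ v) ≃o sub P (φ w)),
      (∀ (s : sub T v), ω (φ.restr v s) = φ.restr w (τ s)) ∧ ∀ y, f (ω y) = f y := by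
  have heq : Equivalent (φ.restr v) (φ.restr w) := by
    rw [← hc]
    by_cases h1 : φ v = ⊥
    · by_cases h2 : φ w = ⊥
      · rw [h1, h2]
      · obtain ⟨p, hp⟩ := exists_parent h2
        rw [h1, hf0, hf _ _ hp] at h
        exact absurd h (by simp)
    · obtain ⟨p, hp⟩ := exists_parent h1
      by_cases h2 : φ w = ⊥
      · rw [h2, hf0, hf _ _ hp] at h
        exact absurd h (by simp)
      · obtain ⟨q, hq⟩ := exists_parent h2
        rw [hf _ _ hp, hf _ _ hq] at h
        exact (List.cons.inj h).1
  obtain ⟨τ, ω, hω⟩ := heq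
  have hω' : ∀ (s : T) (hs : v ≤ s), (ω ⟨φ s, φ.monotone hs⟩ : P) = φ (τ ⟨s, hs⟩) := fun s hs =>
    congrArg (fun z : sub P (φ w) => (z : P)) (hω ⟨s, hs⟩)
  refine ⟨τ, ω, hω, ?_⟩
  have hcω : ∀ (s : T) (hs : v ≤ s), c (φ (τ ⟨s, hs⟩)) = c (φ s) := by
    intro s hs
    rw [eq_comm, hc]
    have hz : (ω ⟨φ s, φ.monotone hs⟩ : P) = φ (τ ⟨s, hs⟩) := hω' s hs
    refine ⟨subIsoRestrict τ ⟨s, hs⟩,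
      (subIsoRestrict ω ⟨φ s, φ.monotone hs⟩).trans (subIsoCast hz), fun t => Subtype.ext ?_⟩
    exact hω' t (le_trans hs t.2)
  rintro ⟨y, hy⟩
  induction y using tree_induction with
  | hbot =>
    have h1 : φ v = ⊥ := le_bot_iff.1 hy
    have h2 : (⟨⊥, hy⟩ : sub P (φ v)) = ⟨φ v, le_rfl⟩ := Subtype.ext h1.symm
    rw [h2, subIso_root]
    exact h.symm
  | hstep x y hxy ih =>
    have hy' : φ v ≤ y := hy
    rcases hy'.eq_or_lt with h1 | h1
    · have h2 : (⟨y, hy⟩ : sub P (φ v)) = ⟨φ v, le_rfl⟩ := Subtype.ext h1.symm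
      rw [h2, subIso_root]
      exact h.symm
    · have h2 := Order.le_pred_of_lt h1
      rw [Order.pred_eq_of_covBy hxy] at h2
      have h3 := subIso_covBy ω (a := ⟨x, h2⟩) (b := ⟨y, hy⟩) hxy
      rw [hf _ _ h3, ih h2, hf _ _ hxy]
      obtain ⟨s, hs, rfl⟩ := hφ.exists_le_lift y hy
      rw [hω' s hs, hcω]

/-- The quotient tree is the set of colour paths. The final clause couples the isomorphisms of `T`,
of `P` and the map `α`, whereas `IsQuotient` only gives separate isomorphisms at internal vertices;
this makes the labels independent of the vertex at which they are read. -/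
theorem IsComposition.exists_quotient {φ : TreeHom T P} (hφ : IsComposition φ) :
    ∃ (Q : RootedTree.{u}) (α : TreeHom P Q), IsQuotient φ α ∧
      ∀ v w : T, α (φ v) = α (φ w) →
        ∃ (τ : sub T v ≃o sub T w) (ω : sub P (φ v) ≃o sub P (φ w)),
          (∀ (s : sub T v), ω (φ.restr v s) = φ.restr w (τ s)) ∧ ∀ y, α (ω y) = α y := by
  obtain ⟨K, c, hc⟩ := hφ.exists_type
  obtain ⟨f, hf0, hf⟩ := exists_path c
  let Q : RootedTree.{u} := pathTree (Set.range f) ⟨⊥, hf0⟩ (by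
    rintro k l ⟨y, hy⟩
    obtain ⟨x, hx⟩ := exists_parent (w := y) fun h => by
      rw [h, hf0] at hy; exact absurd hy (by simp)
    rw [hf _ _ hx] at hy
    exact ⟨x, (List.cons.inj hy).2⟩)
  let α : TreeHom P Q :=
    { toFun := fun y => ⟨f y, y, rfl⟩
      map_bot := Subtype.ext hf0
      map_covBy := fun x y h => pathTree_covBy_iff.2 ⟨c y, hf _ _ h⟩ }
  have hα : ∀ x y, α x = α y ↔ f x = f y := fun x y => Subtype.ext_iff
  have hsurj : Function.Surjective α := by
    rintro ⟨_, y, rfl⟩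
    exact ⟨y, rfl⟩
  have hcov : ∀ x b, α x ⋖ b → ∃ x' y, x' ⋖ y ∧ f x' = f x ∧ b = α y := by
    intro x b hb
    obtain ⟨y, rfl⟩ := hsurj b
    obtain ⟨k, hk⟩ := pathTree_covBy_iff.1 hb
    have hk : f y = k :: f x := hk
    obtain ⟨x', hx'⟩ := exists_parent (w := y) fun h => by
      rw [h, hf0] at hk; exact absurd hk (by simp)
    rw [hf _ _ hx'] at hk
    exact ⟨x', y, hx', (List.cons.inj hk).2, rfl⟩
  have hB : ∀ v w : T, f (φ v) = f (φ w) →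
      ∃ (τ : sub T v ≃o sub T w) (ω : sub P (φ v) ≃o sub P (φ w)),
      (∀ (s : sub T v), ω (φ.restr v s) = φ.restr w (τ s)) ∧ ∀ y, f (ω y) = f y :=
    fun v w h => exists_path_preserving hφ hc hf0 hf h
  have hint : ∀ x y, f x = f y → (IsInternal x ↔ IsInternal y) := by
    intro x y h
    obtain ⟨v, rfl⟩ := hφ.surjective x
    obtain ⟨w, rfl⟩ := hφ.surjective y
    obtain ⟨τ, -⟩ := hB v w h
    rw [hφ.isInternal_iff, hφ.isInternal_iff, ← subIso_isInternal τ ⟨v, le_rfl⟩, subIso_root]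
  have hleaf : ∀ x : P, IsLeaf x → IsLeaf (α x) := by
    intro x hx b hb
    obtain ⟨x', y, h1, h2, -⟩ := hcov x b hb
    exact hx.not_isInternal ((hint _ _ h2).1 ⟨y, h1⟩)
  refine ⟨Q, α, ⟨⟨hsurj, hleaf, ?_⟩, ?_, ?_, ?_⟩, ?_⟩
  · intro x y hxy _ _ h
    obtain ⟨v, rfl⟩ := hφ.surjective x
    obtain ⟨w, rfl⟩ := hφ.surjective y
    obtain ⟨τ, ω, -, h2⟩ := hB v w ((hα _ _).1 h)
    obtain ⟨g, hg⟩ := exists_swap_iso hxy ω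
    refine ⟨g, ?_, fun t ht => ?_⟩
    · rw [hg _ le_rfl, subIso_root]
    · rw [hg _ ht, hα, h2]
  · intro x y hxy hy
    refine ⟨hleaf y hy, fun b hb hbl => ?_⟩
    obtain ⟨x', y', h1, h2, rfl⟩ := hcov x b hb
    have hy' : IsLeaf y' := by
      rw [← not_isInternal_iff] at hbl ⊢
      exact fun h => hbl (α.isInternal_map h)
    rw [hα, hf _ _ h1, hf _ _ hxy, h2]
    congr 1
    obtain ⟨v, rfl⟩ := hφ.surjective y'
    obtain ⟨w, rfl⟩ := hφ.surjective y
    rw [hc]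
    exact ⟨leafIso ((hφ.isLeaf_iff _).1 hy') ((hφ.isLeaf_iff _).1 hy), leafIso hy' hy,
      fun t => Subtype.ext rfl⟩
  · rintro a b hab - - v w ⟨-, p, hv, hw⟩ rfl rfl h
    refine hab.1 ((hα _ _).2 ?_)
    rw [hf _ _ (φ.map_covBy _ _ hv), hf _ _ (φ.map_covBy _ _ hw), (hc v w).2 h]
  · intro v w _ _ h
    obtain ⟨τ, ω, h1, h2⟩ := hB v w ((hα _ _).1 h)
    refine ⟨⟨τ, ω, h1⟩, τ, fun t => ?_⟩
    rw [hα]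
    have h3 := h2 (φ.restr v t)
    rw [h1 t] at h3
    exact h3.symm
  · intro v w h
    obtain ⟨τ, ω, h1, h2⟩ := hB v w ((hα _ _).1 h)
    exact ⟨τ, ω, h1, fun y => (hα _ _).2 (h2 y)⟩

theorem exists_youngDiagram {X : Type*} [Finite X] (f : X → ℕ) (hf : ∀ x, 0 < f x) :
    ∃ (μ : YoungDiagram) (e : Fin μ.rowLens.length ≃ X), ∀ i, μ.rowLens.get i = f (e i) := by
  obtain ⟨n, ⟨e₀⟩⟩ := Finite.exists_equiv_fin X
  let e : Fin n ≃ X := (Tuple.sort fun i => OrderDual.toDual (f (e₀.symm i))).trans e₀.symm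
  have hanti : Antitone fun i => f (e i) := Tuple.monotone_sort fun i =>
    OrderDual.toDual (f (e₀.symm i))
  let w : List ℕ := List.ofFn fun i => f (e i)
  have hpos : ∀ x ∈ w, 0 < x := by
    intro x hx
    obtain ⟨i, rfl⟩ := List.mem_ofFn.1 hx
    exact hf _
  refine ⟨YoungDiagram.ofRowLens w (List.sortedGE_ofFn_iff.2 hanti), ?_⟩
  rw [YoungDiagram.rowLens_ofRowLens_eq_self hpos]
  exact ⟨(finCongr (List.length_ofFn)).trans e, fun i => by simp [w]; rfl⟩

theorem IsComposition.exists_treeOfPartitions [Finite T] {φ : TreeHom T P}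
    (hφ : IsComposition φ) : ∃ Λ : Labeling.{u}, IsTreeOfPartitions φ Λ := by
  classical
  obtain ⟨Q, α, hα, hiso⟩ := hφ.exists_quotient
  have hP : Finite P := Finite.of_surjective _ hφ.surjective
  have hex : ∀ b : Q, ∃ μ : YoungDiagram, ∀ v : T, α (φ v) ⋖ b →
      ∃ e : Fin μ.rowLens.length ≃ {y : P // φ v ⋖ y ∧ α y = b},
        ∀ i, μ.rowLens.get i = Nat.card {w : T // v ⋖ w ∧ φ w = (e i).1} := by
    intro b
    by_cases hb : ∃ v : T, α (φ v) ⋖ b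
    · obtain ⟨v, hv⟩ := hb
      obtain ⟨μ, e, he⟩ := exists_youngDiagram
        (fun y : {y : P // φ v ⋖ y ∧ α y = b} => Nat.card {w : T // v ⋖ w ∧ φ w = y.1}) (by
          rintro ⟨y, hy, -⟩
          obtain ⟨w, hw, hwy⟩ := hφ.exists_child hy
          have : Nonempty {w : T // v ⋖ w ∧ φ w = y} := ⟨⟨w, hw, hwy⟩⟩
          exact Nat.card_pos)
      refine ⟨μ, fun v' hv' => ?_⟩
      obtain ⟨τ, ω, h1, h2⟩ := hiso v v' (parent_unique hv hv')
      let E : {y : P // φ v ⋖ y ∧ α y = b} ≃ {y : P // φ v' ⋖ y ∧ α y = b} :=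
        (Equiv.subtypeSubtypeEquivSubtypeInter (fun y => φ v ⋖ y) (fun y => α y = b)).symm.trans
        (((childEquiv ω).subtypeEquiv fun y => by rw [childEquiv_apply, h2]).trans
        (Equiv.subtypeSubtypeEquivSubtypeInter (fun y => φ v' ⋖ y) (fun y => α y = b)))
      have hE : ∀ y, (E y : P) = ω ⟨y.1, y.2.1.le⟩ := fun y => rfl
      refine ⟨e.trans E, fun i => ?_⟩
      rw [he]
      refine card_children_congr (childEquiv τ) fun t => ?_
      have h3 : (ω ⟨φ t, φ.monotone t.2.le⟩ : P) = φ (τ ⟨t, t.2.le⟩) :=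
        congrArg (fun z : sub P (φ v') => (z : P)) (h1 ⟨t, t.2.le⟩)
      rw [childEquiv_apply, Equiv.trans_apply, hE, ← h3]
      constructor
      · intro h
        congr 2
        exact Subtype.ext h
      · intro h
        exact congrArg (fun z : sub P (φ v) => (z : P)) (ω.injective (Subtype.ext h))
    -- Only the root is not below some `α (φ v)`; its label is a dummy.
    · exact ⟨⊥, fun v hv => absurd ⟨v, hv⟩ hb⟩
  choose lab hlab using hex
  exact ⟨⟨Q, lab⟩, α, hα, fun v b h => hlab b v h⟩

end Quotient

/-! ### Height -/

section Height

variable {T T' : RootedTree.{u}}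

/-- The subtree at the vertex has height at most `n`. -/
def HeightLE {T : RootedTree.{u}} : ℕ → T → Prop
  | 0, v => IsLeaf v
  | n + 1, v => ∀ c, v ⋖ c → HeightLE n c

theorem IsLeaf.heightLE {v : T} (h : IsLeaf v) (n : ℕ) : HeightLE n v := by
  cases n with
  | zero => exact h
  | succ n => exact fun c hc => absurd hc (h c)

theorem HeightLE.mono {n m : ℕ} {v : T} (h : HeightLE n v) (hnm : n ≤ m) : HeightLE m v := by
  induction n generalizing m v with
  | zero => exact IsLeaf.heightLE h m
  | succ n ih =>
    obtain ⟨m, rfl⟩ := Nat.exists_eq_add_of_le' (Nat.one_le_of_lt hnm)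
    exact fun c hc => ih (h c hc) (by omega)

theorem HeightLE.of_iso {n : ℕ} {v : T} {w : T'} (γ : sub T v ≃o sub T' w) (h : HeightLE n v) :
    HeightLE n w := by
  induction n generalizing v w with
  | zero =>
    have h1 := (subIso_isLeaf γ ⟨v, le_rfl⟩).2 h
    rwa [subIso_root] at h1
  | succ n ih =>
    intro d hd
    obtain ⟨c, hc⟩ := (childEquiv γ).surjective ⟨d, hd⟩
    have h1 := ih (subIsoRestrict γ ⟨c, c.2.le⟩) (h c c.2)
    rwa [← childEquiv_apply, hc] at h1

/-- A subtree of a subtree. -/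
def subSubIso (v : T) (w : sub T v) : sub (sub T v) w ≃o sub T (w : T) where
  toFun s := ⟨((s : sub T v) : T), s.2⟩
  invFun s := ⟨⟨s, le_trans w.2 s.2⟩, s.2⟩
  left_inv _ := rfl
  right_inv _ := rfl
  map_rel_iff' := Iff.rfl

/-- The subtree at the root. -/
def subBotIso (T : RootedTree.{u}) : sub T ⊥ ≃o T where
  toFun s := s
  invFun s := ⟨s, bot_le⟩
  left_inv _ := rfl
  right_inv _ := rfl
  map_rel_iff' := Iff.rfl

/-- Levels strictly increase from parent to child, so a bound on the levels of descendants drops by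
one at each child. -/
theorem heightLE_of_ncard [Finite T] (n : ℕ) (v : T)
    (h : ∀ w, v ≤ w → (Set.Iio w).ncard ≤ (Set.Iio v).ncard + n) : HeightLE n v := by
  have hlt : ∀ {v c : T}, v ⋖ c → (Set.Iio v).ncard < (Set.Iio c).ncard := fun {v c} hc =>
    Set.ncard_lt_ncard ⟨Set.Iio_subset_Iio hc.le, fun h => lt_irrefl v (h hc.lt)⟩ (Set.toFinite _)
  induction n generalizing v with
  | zero => exact fun c hc => (hlt hc).not_ge (h c hc.le)
  | succ n ih =>
    intro c hc
    refine ih c fun w hw => ?_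
    have h1 := h w (hc.le.trans hw)
    have h2 := hlt hc
    omega

theorem heightLE_height [Finite T] : HeightLE (height T) (⊥ : T) := by
  refine heightLE_of_ncard _ _ fun w _ => ?_
  have h1 : (Set.Iio w).ncard ≤ height T :=
    le_ciSup (f := fun v : T => (Set.Iio v).ncard) (Set.finite_range _).bddAbove w
  omega

theorem IsComposition.heightLE_iff {φ : TreeHom T T'} (hφ : IsComposition φ) {n : ℕ} {v : T} :
    HeightLE n (φ v) ↔ HeightLE n v := by
  induction n generalizing v with
  | zero => exact hφ.isLeaf_iff v
  | succ n ih =>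
    constructor
    · exact fun h c hc => ih.1 (h _ (φ.map_covBy _ _ hc))
    · intro h y hy
      obtain ⟨c, hc, rfl⟩ := hφ.exists_child hy
      exact ih.2 (h c hc)

end Height

/-! ### Isomorphisms of labelings -/

section LabelingIso

theorem Labeling.Iso.symm {Λ Ξ : Labeling.{u}} (h : Λ.Iso Ξ) : Ξ.Iso Λ := by
  obtain ⟨γ, hγ⟩ := h
  refine ⟨γ.symm, fun a ha => ?_⟩
  rw [hγ _ fun h => ha (by rw [← γ.apply_symm_apply a, h, γ.map_bot]), γ.apply_symm_apply]

theorem Labeling.Iso.trans {Λ Ξ Θ : Labeling.{u}} (h : Λ.Iso Ξ) (h' : Ξ.Iso Θ) : Λ.Iso Θ := by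
  obtain ⟨γ, hγ⟩ := h
  obtain ⟨δ, hδ⟩ := h'
  refine ⟨γ.trans δ, fun a ha => ?_⟩
  rw [hγ a ha, hδ _ fun h => ha (γ.injective (h.trans γ.map_bot.symm)), OrderIso.trans_apply]

theorem Labeling.sub_sub_iso (Λ : Labeling.{u}) (a : Λ.tree) (c : TreeComp.sub Λ.tree a) :
    (Labeling.sub (Λ.sub a) c).Iso (Λ.sub (c : Λ.tree)) :=
  ⟨subSubIso a c, fun _ _ => rfl⟩

theorem Labeling.sub_bot_iso (Λ : Labeling.{u}) : (Λ.sub ⊥).Iso Λ :=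
  ⟨subBotIso Λ.tree, fun _ _ => rfl⟩

theorem sub_isLeaf_iff {T : RootedTree.{u}} {a : T} (c : sub T a) :
    IsLeaf c ↔ IsLeaf (c : T) := by
  constructor
  · intro h w hw
    exact h ⟨w, le_trans c.2 hw.le⟩ (sub_covBy hw)
  · exact fun h w hw => h _ (covBy_of_sub hw)

theorem sub_isInternal_iff {T : RootedTree.{u}} {a : T} (c : sub T a) :
    IsInternal c ↔ IsInternal (c : T) := by
  rw [← not_isLeaf_iff, sub_isLeaf_iff, not_isLeaf_iff]

theorem Labeling.Good.sub {Λ : Labeling.{u}} (h : Λ.Good) (a : Λ.tree) : (Λ.sub a).Good := by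
  intro (b : TreeComp.sub Λ.tree a) (c : TreeComp.sub Λ.tree a) (c' : TreeComp.sub Λ.tree a)
    hc hc' h'
  refine Subtype.ext (h b c c' (covBy_of_sub hc) (covBy_of_sub hc') ?_)
  rcases h' with ⟨h1, h2⟩ | ⟨h1, h2, h3⟩
  · exact Or.inl ⟨(sub_isLeaf_iff c).1 h1, (sub_isLeaf_iff c').1 h2⟩
  · exact Or.inr ⟨(sub_isInternal_iff c).1 h1, (sub_isInternal_iff c').1 h2,
      ((Λ.sub_sub_iso a c).symm.trans h3).trans (Λ.sub_sub_iso a c')⟩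

end LabelingIso

/-! ### Codes of labelings in linear orders -/

section Codes

/-- Linearly ordered types of invariants of the labelings of height at most `n`. -/
def Code : ℕ → Type
  | 0 => PUnit
  -- Colexicographic order is decided by the greatest key in the symmetric difference, as is the
  -- lexicographic comparison of decreasing lists.
  | n + 1 => Colex (Finset (WithBot (Code n) ×ₗ ℕ ×ₗ List ℕ))

/-- The order of the keys obtained from an order of the codes. -/
noncomputable abbrev colexKeyOrder (α : Type) [LinearOrder α] :
    LinearOrder (Colex (Finset (WithBot α ×ₗ ℕ ×ₗ List ℕ))) := inferInstance

noncomputable instance instLinearOrderCode : (n : ℕ) → LinearOrder (Code n)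
  | 0 => inferInstanceAs (LinearOrder PUnit)
  | n + 1 => @colexKeyOrder (Code n) (instLinearOrderCode n)

/-- The invariants of vertices of the first level. -/
abbrev Key (n : ℕ) : Type := WithBot (Code n) ×ₗ ℕ ×ₗ List ℕ

open Classical in
/-- The key of a vertex with a given label, where `x` is the code of its subtree. -/
noncomputable def mkKey {n : ℕ} {T : RootedTree.{u}} (c : T) (x : Code n) (μ : YoungDiagram) :
    Key n :=
  -- The value `⊥` puts leaves below internal vertices. The constant `0` replaces the size, because
  -- leaves are compared by the partition alone.
  if IsLeaf c then toLex (⊥, toLex (0, μ.rowLens)) else toLex (↑x, toLex (μ.card, μ.rowLens))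

/-- The code of the labeling of the subtree with a given root. -/
noncomputable def Labeling.code (Λ : Labeling.{u}) [Finite Λ.tree] : (n : ℕ) → Λ.tree → Code n
  | 0, _ => PUnit.unit
  | n + 1, a =>
    toColex ((Set.toFinite {c | a ⋖ c}).toFinset.image fun c => mkKey c (Λ.code n c) (Λ.label c))

/-- The key of a vertex of a labeling. -/
noncomputable def Labeling.key (Λ : Labeling.{u}) [Finite Λ.tree] (n : ℕ) (c : Λ.tree) : Key n :=
  mkKey c (Λ.code n c) (Λ.label c)

/-- The keys of the children of a vertex. -/
noncomputable def Labeling.keys (Λ : Labeling.{u}) [Finite Λ.tree] (n : ℕ) (a : Λ.tree) :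
    Finset (Key n) :=
  (Set.toFinite {c | a ⋖ c}).toFinset.image (Λ.key n)

theorem Labeling.code_succ (Λ : Labeling.{u}) [Finite Λ.tree] (n : ℕ) (a : Λ.tree) :
    Λ.code (n + 1) a = toColex (Λ.keys n a) := rfl

theorem Labeling.mem_keys {Λ : Labeling.{u}} [Finite Λ.tree] {n : ℕ} {a : Λ.tree} {k : Key n} :
    k ∈ Λ.keys n a ↔ ∃ c, a ⋖ c ∧ Λ.key n c = k := by
  simp [Labeling.keys]

theorem rowLens_inj {μ ν : YoungDiagram} (h : μ.rowLens = ν.rowLens) : μ = ν :=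
  YoungDiagram.equivListRowLens.injective (Subtype.ext h)

theorem key_of_isLeaf {Λ : Labeling.{u}} [Finite Λ.tree] {n : ℕ} {c : Λ.tree} (h : IsLeaf c) :
    Λ.key n c = toLex (⊥, toLex (0, (Λ.label c).rowLens)) := by
  rw [Labeling.key, mkKey, if_pos h]

theorem key_of_isInternal {Λ : Labeling.{u}} [Finite Λ.tree] {n : ℕ} {c : Λ.tree}
    (h : IsInternal c) :
    Λ.key n c = toLex (↑(Λ.code n c), toLex ((Λ.label c).card, (Λ.label c).rowLens)) := by
  rw [Labeling.key, mkKey, if_neg (not_isLeaf_iff.2 h)]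

theorem key_eq_iff {Λ Ξ : Labeling.{u}} [Finite Λ.tree] [Finite Ξ.tree] {n : ℕ} {c : Λ.tree}
    {d : Ξ.tree} : Λ.key n c = Ξ.key n d ↔ (IsLeaf c ∧ IsLeaf d ∧ Λ.label c = Ξ.label d) ∨
      (IsInternal c ∧ IsInternal d ∧ Λ.code n c = Ξ.code n d ∧ Λ.label c = Ξ.label d) := by
  rcases isLeaf_or_isInternal c with hc | hc <;> rcases isLeaf_or_isInternal d with hd | hd
  · rw [key_of_isLeaf hc, key_of_isLeaf hd]
    have := hc.not_isInternal
    simp only [EmbeddingLike.apply_eq_iff_eq, Prod.mk.injEq, true_and, hc, hd, this, false_and,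
      or_false]
    exact ⟨rowLens_inj, fun h => h ▸ rfl⟩
  · rw [key_of_isLeaf hc, key_of_isInternal hd]
    have := not_isLeaf_iff.2 hd
    have := hc.not_isInternal
    simp [*]
  · rw [key_of_isInternal hc, key_of_isLeaf hd]
    have := not_isLeaf_iff.2 hc
    have := hd.not_isInternal
    simp [*]
  · rw [key_of_isInternal hc, key_of_isInternal hd]
    have := not_isLeaf_iff.2 hc
    simp only [EmbeddingLike.apply_eq_iff_eq, Prod.mk.injEq, hc, hd, this, false_and, true_and,
      false_or, WithBot.coe_inj]
    exact ⟨fun h => ⟨h.1, rowLens_inj h.2.2⟩, fun h => ⟨h.1, h.2 ▸ ⟨rfl, rfl⟩⟩⟩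

theorem code_eq_of_iso {Λ Ξ : Labeling.{u}} [Finite Λ.tree] [Finite Ξ.tree] (n : ℕ) {a : Λ.tree}
    {b : Ξ.tree} (h : (Λ.sub a).Iso (Ξ.sub b)) : Λ.code n a = Ξ.code n b := by
  induction n generalizing a b with
  | zero => rfl
  | succ n ih =>
    obtain ⟨γ, hγ⟩ := Labeling.sub_iso_sub_iff.1 h
    have key : ∀ c : {c // a ⋖ c}, Λ.key n c = Ξ.key n (childEquiv γ c) := by
      intro c
      have h1 : Λ.label c = Ξ.label (childEquiv γ c) := hγ c c.2.lt
      have h2 := ih (Labeling.iso_sub_of_iso γ hγ ⟨c, c.2.le⟩)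
      rw [key_eq_iff]
      rcases isLeaf_or_isInternal c.1 with hc | hc
      · exact Or.inl ⟨hc, (subIso_isLeaf γ ⟨c, c.2.le⟩).2 hc, h1⟩
      · exact Or.inr ⟨hc, (subIso_isInternal γ ⟨c, c.2.le⟩).2 hc, h2, h1⟩
    rw [Labeling.code_succ, Labeling.code_succ]
    congr 1
    ext k
    rw [Labeling.mem_keys, Labeling.mem_keys]
    constructor
    · rintro ⟨c, hc, rfl⟩
      exact ⟨_, (childEquiv γ ⟨c, hc⟩).2, (key ⟨c, hc⟩).symm⟩
    · rintro ⟨d, hd, rfl⟩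
      obtain ⟨c, hc⟩ := (childEquiv γ).surjective ⟨d, hd⟩
      exact ⟨c, c.2, by rw [key, hc]⟩

/-- A set of keys forgets multiplicities, but in a good labeling siblings have distinct keys. Equal
sets thus match the children, and isomorphisms of their subtrees are glued. -/
theorem iso_of_code_eq {Λ Ξ : Labeling.{u}} [Finite Λ.tree] [Finite Ξ.tree] (hΛ : Λ.Good)
    (hΞ : Ξ.Good) {n : ℕ} {a : Λ.tree} {b : Ξ.tree} (ha : HeightLE n a) (hb : HeightLE n b)
    (h : Λ.code n a = Ξ.code n b) : (Λ.sub a).Iso (Ξ.sub b) := by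
  induction n generalizing Λ Ξ with
  | zero =>
    exact Labeling.sub_iso_sub_iff.2 ⟨leafIso ha hb, fun c hc => absurd (ha.eq_of_le hc.le) hc.ne'⟩
  | succ n ih =>
    -- Here the inductive hypothesis compares a labeling with itself, which is why both labelings
    -- are generalized.
    have hinj : ∀ {Θ : Labeling.{u}} [Finite Θ.tree] {a c c' : Θ.tree}, Θ.Good →
        HeightLE (n + 1) a → a ⋖ c → a ⋖ c' → Θ.key n c = Θ.key n c' → c = c' := by
      intro Θ _ a c c' hΘ ha hc hc' hk
      refine hΘ a c c' hc hc' ?_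
      rcases key_eq_iff.1 hk with ⟨h1, h2, -⟩ | ⟨h1, h2, h3, -⟩
      · exact Or.inl ⟨h1, h2⟩
      · exact Or.inr ⟨h1, h2, ih hΘ hΘ (ha c hc) (ha c' hc') h3⟩
    have hkeys : Λ.keys n a = Ξ.keys n b := by
      rw [Labeling.code_succ, Labeling.code_succ] at h
      exact h
    have hex : ∀ c : {c // a ⋖ c}, ∃ d : {d // b ⋖ d}, Ξ.key n d = Λ.key n c := by
      intro c
      have h1 : Λ.key n c ∈ Λ.keys n a := Labeling.mem_keys.2 ⟨c, c.2, rfl⟩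
      rw [hkeys, Labeling.mem_keys] at h1
      obtain ⟨d, hd, h2⟩ := h1
      exact ⟨⟨d, hd⟩, h2⟩
    choose f hf using hex
    have hbij : Function.Bijective f := by
      refine ⟨fun c c' hcc => Subtype.ext (hinj hΛ ha c.2 c'.2 ?_), fun d => ?_⟩
      · rw [← hf, ← hf, hcc]
      · have h1 : Ξ.key n d ∈ Ξ.keys n b := Labeling.mem_keys.2 ⟨d, d.2, rfl⟩
        rw [← hkeys, Labeling.mem_keys] at h1
        obtain ⟨c, hc, h2⟩ := h1
        exact ⟨⟨c, hc⟩, Subtype.ext (hinj hΞ hb (f _).2 d.2 ((hf _).trans h2))⟩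
    have hγ : ∀ c : {c // a ⋖ c}, Λ.label c = Ξ.label (f c) ∧
        ∃ γ : sub Λ.tree c.1 ≃o sub Ξ.tree (f c).1,
          ∀ s (hs : c.1 < s), Λ.label s = Ξ.label (γ ⟨s, hs.le⟩) := by
      intro c
      rcases key_eq_iff.1 (hf c) with ⟨h1, h2, h3⟩ | ⟨h1, h2, h3, h4⟩
      · exact ⟨h3.symm, leafIso h2 h1, fun s hs => absurd (h2.eq_of_le hs.le) hs.ne'⟩
      · exact ⟨h4.symm, Labeling.sub_iso_sub_iff.1
          (ih hΛ hΞ (ha c c.2) (hb _ (f c).2) h3.symm)⟩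
    choose hl γ hγ using hγ
    obtain ⟨Z, hZ⟩ := exists_glued_iso (Equiv.ofBijective f hbij) γ
    refine Labeling.sub_iso_sub_iff.2 ⟨Z, fun s hs => ?_⟩
    obtain ⟨c, hc, hcs⟩ := exists_child_le hs
    have h1 := hZ ⟨c, hc⟩ s hcs
    rw [h1]
    rcases hcs.eq_or_lt with h2 | h2
    · subst h2
      exact (hl ⟨c, hc⟩).trans (congrArg Ξ.label (subIso_root (γ ⟨c, hc⟩)).symm)
    · exact hγ ⟨c, hc⟩ s h2

/-- The first component alone, being the code or the mark of a leaf, already separates siblings; the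
partition plays no role. -/
theorem Labeling.Good.key_injective {Λ : Labeling.{u}} [Finite Λ.tree] (hΛ : Λ.Good) {n : ℕ}
    {a c c' : Λ.tree} (ha : HeightLE (n + 1) a) (hc : a ⋖ c) (hc' : a ⋖ c')
    (h : (ofLex (Λ.key n c)).1 = (ofLex (Λ.key n c')).1) : c = c' := by
  refine hΛ a c c' hc hc' ?_
  rcases isLeaf_or_isInternal c with h1 | h1 <;> rcases isLeaf_or_isInternal c' with h2 | h2
  · exact Or.inl ⟨h1, h2⟩
  · rw [key_of_isLeaf h1, key_of_isInternal h2] at h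
    exact absurd h.symm (WithBot.coe_ne_bot)
  · rw [key_of_isInternal h1, key_of_isLeaf h2] at h
    exact absurd h (WithBot.coe_ne_bot)
  · rw [key_of_isInternal h1, key_of_isInternal h2] at h
    exact Or.inr ⟨h1, h2, iso_of_code_eq hΛ hΛ (ha c hc) (ha c' hc') (WithBot.coe_inj.1 h)⟩

/-- Above `w` the two decreasing lists have the same entries, so they agree until `L₁` reaches `w`,
where `L₂` has something smaller or has ended. -/
theorem list_lt_of_first_difference {α : Type*} [LinearOrder α] {L₁ L₂ : List α}
    (h₁ : L₁.Pairwise (· > ·)) (h₂ : L₂.Pairwise (· > ·)) {w : α} (hw : w ∈ L₁) (hw' : w ∉ L₂)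
    (h : ∀ x, w < x → (x ∈ L₁ ↔ x ∈ L₂)) : L₂ < L₁ := by
  induction L₁ generalizing L₂ with
  | nil => simp at hw
  | cons x L₁ ih =>
    cases L₂ with
    | nil => exact List.Lex.nil
    | cons y L₂ =>
      rw [List.pairwise_cons] at h₁ h₂
      rcases lt_trichotomy x y with hxy | rfl | hxy
      · exfalso
        have hwx : w ≤ x := by
          rcases List.mem_cons.1 hw with h3 | h3
          · exact h3.le
          · exact (h₁.1 w h3).le
        rcases List.mem_cons.1 ((h y (hwx.trans_lt hxy)).2 List.mem_cons_self) with h3 | h3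
        · exact hxy.ne' h3
        · exact lt_asymm hxy (h₁.1 y h3)
      · have hwx : w ≠ x := fun h3 => hw' (h3 ▸ List.mem_cons_self)
        refine List.Lex.cons (ih h₁.2 h₂.2 ((List.mem_cons.1 hw).resolve_left hwx)
          (fun h3 => hw' (List.mem_cons_of_mem _ h3)) fun z hz => ?_)
        have h3 := h z hz
        simp only [List.mem_cons] at h3
        by_cases hzx : z = x
        · subst hzx
          exact iff_of_false (fun h4 => lt_irrefl z (h₁.1 z h4)) fun h4 => lt_irrefl z (h₂.1 z h4)
        · simpa [hzx] using h3
      · exact List.Lex.rel hxy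

theorem exists_greatest_difference_of_colex_lt {α : Type*} [LinearOrder α] {s t : Finset α}
    (h : toColex s < toColex t) : ∃ w ∈ t, w ∉ s ∧ ∀ x, w < x → (x ∈ s ↔ x ∈ t) := by
  obtain ⟨w, hw, h1⟩ := Finset.Colex.lt_iff_exists_filter_lt.1 h
  rw [Finset.mem_sdiff] at hw
  refine ⟨w, hw.1, hw.2, fun x hx => ?_⟩
  have h2 := Finset.ext_iff.1 h1 x
  simpa [hx] using h2

theorem Labeling.exists_enumeration (Λ : Labeling.{u}) [Finite Λ.tree] (n : ℕ) (hΛ : Λ.Good)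
    (h : HeightLE (n + 1) (⊥ : Λ.tree)) :
    ∃ L : List (Key n), L.Pairwise (· > ·) ∧ (∀ k, k ∈ L ↔ k ∈ Λ.keys n ⊥) ∧
      ∃ a : Fin L.length → FirstLevel Λ.tree, Function.Surjective a ∧
        ∀ i, Λ.key n (a i).1 = L.get i := by
  refine ⟨(Λ.keys n ⊥).sort (· ≥ ·), ?_, fun k => Finset.mem_sort _, ?_⟩
  · exact (Finset.sortedGT_sort _).pairwise
  · generalize hL : (Λ.keys n ⊥).sort (· ≥ ·) = L
    have hmem : ∀ k, k ∈ L ↔ k ∈ Λ.keys n ⊥ := fun k => hL ▸ Finset.mem_sort _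
    have hex : ∀ i : Fin L.length, ∃ c : FirstLevel Λ.tree, Λ.key n c.1 = L.get i := fun i => by
      obtain ⟨c, hc, h1⟩ := Labeling.mem_keys.1 ((hmem _).1 (L.get_mem i))
      exact ⟨⟨c, hc⟩, h1⟩
    choose a ha using hex
    refine ⟨a, fun c => ?_, ha⟩
    obtain ⟨i, hi⟩ := List.get_of_mem ((hmem _).2 (Labeling.mem_keys.2 ⟨c, c.2, rfl⟩))
    exact ⟨i, Subtype.ext (hΛ.key_injective h (a i).2 c.2 (by rw [ha, hi]))⟩

theorem vertexEq_iff {Λ Ξ : Labeling.{u}} [Finite Λ.tree] [Finite Ξ.tree] {n : ℕ} (hΛ : Λ.Good)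
    (hΞ : Ξ.Good) (h : HeightLE (n + 1) (⊥ : Λ.tree)) (h' : HeightLE (n + 1) (⊥ : Ξ.tree))
    (a : FirstLevel Λ.tree) (b : FirstLevel Ξ.tree) :
    VertexEq Λ Ξ a b ↔ Λ.key n a.1 = Ξ.key n b.1 := by
  rw [key_eq_iff, VertexEq]
  refine or_congr Iff.rfl (and_congr Iff.rfl (and_congr Iff.rfl (and_congr ?_ Iff.rfl)))
  exact ⟨code_eq_of_iso n, iso_of_code_eq hΛ hΞ (h _ a.2) (h' _ b.2)⟩

instance (Λ : Labeling.{u}) [Finite Λ.tree] (a : Λ.tree) : Finite (Λ.sub a).tree :=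
  Subtype.finite (α := Λ.tree)

theorem code_sub_bot (Λ : Labeling.{u}) [Finite Λ.tree] (a : Λ.tree) (n : ℕ) :
    (Λ.sub a).code n ⊥ = Λ.code n a :=
  code_eq_of_iso n (Λ.sub a).sub_bot_iso

/-- The sorted keys enumerate the first levels in decreasing order, and a strict inequality of keys
gives `VertexGT`. The greatest difference of the two key sets then becomes the first difference of
the two lists. -/
theorem gtAt_of_code_lt {n : ℕ} {Λ Ξ : Labeling.{u}} [Finite Λ.tree] [Finite Ξ.tree]
    (hΛ : Λ.Good) (hΞ : Ξ.Good) (h : HeightLE n (⊥ : Λ.tree)) (h' : HeightLE n (⊥ : Ξ.tree))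
    (hlt : Ξ.code n ⊥ < Λ.code n ⊥) : GTAt n Λ Ξ := by
  induction n generalizing Λ Ξ with
  | zero => exact absurd hlt (lt_irrefl _)
  | succ n ih =>
    have hgt : ∀ {Λ Ξ : Labeling.{u}} [Finite Λ.tree] [Finite Ξ.tree], Λ.Good → Ξ.Good →
        HeightLE (n + 1) (⊥ : Λ.tree) → HeightLE (n + 1) (⊥ : Ξ.tree) →
        ∀ (a : FirstLevel Λ.tree) (b : FirstLevel Ξ.tree), Ξ.key n b.1 < Λ.key n a.1 →
          VertexGT (GTAt n) Λ Ξ a b := by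
      intro Λ Ξ _ _ hΛ hΞ h h' a b hlt
      refine ⟨fun he => hlt.ne' ((vertexEq_iff hΛ hΞ h h' a b).1 he), ?_⟩
      rcases isLeaf_or_isInternal a.1 with h1 | h1 <;> rcases isLeaf_or_isInternal b.1 with h2 | h2
      · rw [key_of_isLeaf h1, key_of_isLeaf h2] at hlt
        simp only [Prod.Lex.toLex_lt_toLex, lt_irrefl, false_or, true_and] at hlt
        exact Or.inl ⟨h1, h2, hlt⟩
      · rw [key_of_isLeaf h1, key_of_isInternal h2] at hlt
        simp [Prod.Lex.toLex_lt_toLex] at hlt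
      · exact Or.inr (Or.inl ⟨h1, h2⟩)
      · rw [key_of_isInternal h1, key_of_isInternal h2] at hlt
        simp only [Prod.Lex.toLex_lt_toLex, WithBot.coe_lt_coe, WithBot.coe_inj] at hlt
        rcases hlt with h3 | ⟨h3, h4⟩
        · refine Or.inr (Or.inr (Or.inl ⟨h1, h2, ih (hΛ.sub _) (hΞ.sub _) ?_ ?_ ?_⟩))
          · exact (h _ a.2).of_iso (subBotIso (sub Λ.tree a.1)).symm
          · exact (h' _ b.2).of_iso (subBotIso (sub Ξ.tree b.1)).symm
          · rwa [code_sub_bot, code_sub_bot]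
        · have h5 := iso_of_code_eq hΛ hΞ (h _ a.2) (h' _ b.2) h3.symm
          rcases h4 with h4 | ⟨h4, h6⟩
          · exact Or.inr (Or.inr (Or.inr (Or.inl ⟨h1, h2, h5, h4⟩)))
          · exact Or.inr (Or.inr (Or.inr (Or.inr ⟨h1, h2, h5, h4.symm, h6⟩)))
    obtain ⟨L, hL, hLm, a, ha, hak⟩ := Λ.exists_enumeration n hΛ h
    obtain ⟨M, hM, hMm, b, hb, hbk⟩ := Ξ.exists_enumeration n hΞ h'
    refine ⟨L.length, M.length, a, b, ha, fun i j hij => hgt hΛ hΛ h h _ _ ?_, hb,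
      fun i j hij => hgt hΞ hΞ h' h' _ _ ?_, ?_⟩
    · rw [hak, hak]
      exact List.pairwise_iff_get.1 hL i j hij
    · rw [hbk, hbk]
      exact List.pairwise_iff_get.1 hM i j hij
    have hlt : toColex (Ξ.keys n ⊥) < toColex (Λ.keys n ⊥) := hlt
    obtain ⟨w, hw, hw', hw''⟩ := exists_greatest_difference_of_colex_lt hlt
    rw [← hLm] at hw
    rw [← hMm] at hw'
    have hlt' : M < L := list_lt_of_first_difference hL hM hw hw' fun x hx => by
      rw [hLm, hMm, hw'' x hx]
    rcases List.lt_iff_exists.1 hlt' with ⟨h1, h2⟩ | ⟨j, hj₁, hj₂, h1, h2⟩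
    · refine Or.inl ⟨h2, fun i => (vertexEq_iff hΛ hΞ h h' _ _).2 ?_⟩
      rw [hak, hbk]
      have h3 : M[i.1]? = L[i.1]? := (congrArg (fun l : List (Key n) => l[i.1]?) h1).trans (by
        rw [List.getElem?_take, if_pos i.2])
      rw [List.getElem?_eq_getElem i.2, List.getElem?_eq_getElem (i.2.trans h2)] at h3
      exact (Option.some.inj h3).symm
    · refine Or.inr ⟨j, hj₂, hj₁, fun i hi => (vertexEq_iff hΛ hΞ h h' _ _).2 ?_,
        hgt hΛ hΞ h h' _ _ ?_⟩
      · rw [hak, hbk]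
        exact (h1 i hi).symm
      · rw [hak, hbk]
        exact h2

end Codes

/-! ### Zero-one matrices -/

section GaleRyser

theorem rowLens_lt_of_rowLen {μ ν : YoungDiagram} {i : ℕ}
    (h : ∀ j < i, μ.rowLen j = ν.rowLen j) (hi : μ.rowLen i < ν.rowLen i) :
    μ.rowLens < ν.rowLens := by
  have hlen : ∀ (μ : YoungDiagram) (i : ℕ), i < μ.rowLens.length ↔ 0 < μ.rowLen i := by
    intro μ i
    rw [YoungDiagram.length_rowLens, ← YoungDiagram.mem_iff_lt_colLen,
      YoungDiagram.mem_iff_lt_rowLen]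
  have hν : i < ν.rowLens.length := (hlen ν i).2 (by omega)
  rw [List.lt_iff_exists]
  by_cases hμ : i < μ.rowLens.length
  · refine Or.inr ⟨i, hμ, hν, fun j hj => ?_, ?_⟩
    · rw [YoungDiagram.get_rowLens, YoungDiagram.get_rowLens, h j hj]
    · rwa [YoungDiagram.get_rowLens, YoungDiagram.get_rowLens]
  -- Zero rows are not listed, so in this case the list of `μ` ends first and is a proper initial
  -- segment.
  · have hlt : μ.rowLens.length < ν.rowLens.length := by omega
    refine Or.inl ⟨List.ext_getElem (by rw [List.length_take]; omega) fun j h1 h2 => ?_, hlt⟩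
    rw [List.getElem_take, YoungDiagram.get_rowLens, YoungDiagram.get_rowLens, h j (by omega)]

theorem eq_of_rowLen_eq {μ ν : YoungDiagram} (h : ∀ i, μ.rowLen i = ν.rowLen i) : μ = ν := by
  refine YoungDiagram.ext (Finset.ext fun ⟨i, j⟩ => ?_)
  rw [YoungDiagram.mem_cells, YoungDiagram.mem_cells, YoungDiagram.mem_iff_lt_rowLen,
    YoungDiagram.mem_iff_lt_rowLen, h]

/-- The dominance order is coarser than the lexicographic order. -/
theorem rowLens_le_of_dominance {μ ν : YoungDiagram}
    (h : ∀ k, ∑ i ∈ Finset.range k, μ.rowLen i ≤ ∑ i ∈ Finset.range k, ν.rowLen i) :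
    μ.rowLens ≤ ν.rowLens := by
  classical
  by_cases hex : ∃ i, μ.rowLen i ≠ ν.rowLen i
  · have hmin : ∀ j < Nat.find hex, μ.rowLen j = ν.rowLen j := fun j hj =>
      not_not.1 (Nat.find_min hex hj)
    have h1 := h (Nat.find hex + 1)
    have h2 : ∑ i ∈ Finset.range (Nat.find hex), μ.rowLen i =
        ∑ i ∈ Finset.range (Nat.find hex), ν.rowLen i :=
      Finset.sum_congr rfl fun j hj => hmin j (Finset.mem_range.1 hj)
    rw [Finset.sum_range_succ, Finset.sum_range_succ, h2] at h1
    exact (rowLens_lt_of_rowLen hmin (lt_of_le_of_ne (by omega) (Nat.find_spec hex))).le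
  · push Not at hex
    rw [eq_of_rowLen_eq hex]

theorem rowLen_eq_zero_of_le {μ : YoungDiagram} {i : ℕ} (h : μ.rowLens.length ≤ i) :
    μ.rowLen i = 0 := by
  rw [YoungDiagram.length_rowLens] at h
  by_contra h0
  have h1 : (i, 0) ∈ μ := YoungDiagram.mem_iff_lt_rowLen.2 (Nat.pos_of_ne_zero h0)
  exact absurd (YoungDiagram.mem_iff_lt_colLen.1 h1) (by omega)

variable {W X Y : Type*} {μ ν : YoungDiagram}

theorem card_fiber_index {p : W → X} (e : Fin μ.rowLens.length ≃ X)
    (he : ∀ i, μ.rowLens.get i = Nat.card {w // p w = e i}) (i : ℕ) :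
    Nat.card {w // (e.symm (p w)).val = i} = μ.rowLen i := by
  by_cases hi : i < μ.rowLens.length
  · have h1 := he ⟨i, hi⟩
    rw [List.get_eq_getElem, YoungDiagram.get_rowLens] at h1
    rw [h1]
    refine Nat.card_congr (Equiv.subtypeEquivRight fun w => ?_)
    rw [← Equiv.symm_apply_eq, Fin.ext_iff]
  · rw [rowLen_eq_zero_of_le (not_lt.1 hi)]
    have : IsEmpty {w // (e.symm (p w)).val = i} :=
      ⟨fun w => hi (w.2 ▸ (e.symm (p w.1)).2)⟩
    exact Nat.card_of_isEmpty

theorem sum_rowLen_eq [Finite W] {p : W → X} (e : Fin μ.rowLens.length ≃ X)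
    (he : ∀ i, μ.rowLens.get i = Nat.card {w // p w = e i}) (k : ℕ) :
    ∑ i ∈ Finset.range k, μ.rowLen i = Nat.card {w // (e.symm (p w)).val < k} := by
  classical
  have := Fintype.ofFinite W
  rw [Nat.card_eq_fintype_card, Fintype.card_subtype,
    Finset.card_eq_sum_card_fiberwise (f := fun w => (e.symm (p w)).val) (t := Finset.range k)
      (fun w hw => by simpa using hw)]
  refine Finset.sum_congr rfl fun i hi => ?_
  rw [← card_fiber_index e he, Nat.card_eq_fintype_card, Fintype.card_subtype, Finset.filter_filter]
  congr 1
  ext w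
  simp only [Finset.mem_filter, Finset.mem_univ, true_and]
  exact ⟨fun h => ⟨h ▸ Finset.mem_range.1 hi, h⟩, fun h => h.2⟩

/-- A column of the diagram of `ν` counts the parts exceeding its index, and the parts are the fibre
sizes of `q`. -/
theorem colLen_eq_card_columns {q : W → Y} (e : Fin ν.rowLens.length ≃ Y)
    (he : ∀ i, ν.rowLens.get i = Nat.card {w // q w = e i}) (j : ℕ) :
    ν.colLen j = Nat.card {y // j < Nat.card {w // q w = y}} := by
  have h1 : ∀ i : Fin ν.rowLens.length, i.val < ν.colLen j ↔ j < Nat.card {w // q w = e i} := by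
    intro i
    rw [← he, List.get_eq_getElem, YoungDiagram.get_rowLens, ← YoungDiagram.mem_iff_lt_colLen,
      YoungDiagram.mem_iff_lt_rowLen]
  rw [← Nat.card_congr (e.subtypeEquiv h1)]
  have hle : ν.colLen j ≤ ν.rowLens.length := by
    rw [YoungDiagram.length_rowLens]
    exact ν.colLen_anti _ _ (Nat.zero_le j)
  refine (Nat.card_fin (ν.colLen j)).symm.trans (Nat.card_congr
    ⟨fun i => ⟨⟨i, i.2.trans_le hle⟩, i.2⟩, fun i => ⟨i.1, i.2⟩,
      fun _ => rfl, fun _ => rfl⟩)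

theorem card_eq_card_of_rows [Finite W] {p : W → X} (e : Fin μ.rowLens.length ≃ X)
    (he : ∀ i, μ.rowLens.get i = Nat.card {w // p w = e i}) : μ.card = Nat.card W := by
  have h1 : μ.card = ∑ i ∈ Finset.range μ.rowLens.length, μ.rowLen i := by
    rw [YoungDiagram.card, Finset.card_eq_sum_card_fiberwise (f := Prod.fst)
      (t := Finset.range μ.rowLens.length)]
    · exact Finset.sum_congr rfl fun i _ => (μ.rowLen_eq_card).symm
    · rintro ⟨i, j⟩ hij
      rw [Finset.mem_coe, YoungDiagram.mem_cells, YoungDiagram.mem_iff_lt_rowLen] at hij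
      simp only [Finset.coe_range, Set.mem_Iio]
      by_contra h
      rw [rowLen_eq_zero_of_le (not_lt.1 h)] at hij
      exact absurd hij (Nat.not_lt_zero j)
  rw [h1, sum_rowLen_eq e he]
  exact Nat.card_congr (Equiv.subtypeUnivEquiv fun w => (e.symm (p w)).2)

theorem transpose_card (μ : YoungDiagram) : μ.transpose.card = μ.card := by
  simp [YoungDiagram.card, YoungDiagram.transpose]

/-- Each cell holds at most one entry, so the first `k` rows contribute at most `k` entries to a
column. Summing over columns gives dominance. -/
theorem card_fiber_lt_le [Finite W] {p : W → X} {q : W → Y} (e : Fin μ.rowLens.length ≃ X)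
    (hinj : ∀ w w', p w = p w' → q w = q w' → w = w') (k : ℕ) (y : Y) :
    Nat.card {w // (e.symm (p w)).val < k ∧ q w = y} ≤ min k (Nat.card {w // q w = y}) := by
  refine le_min ?_ (Nat.card_le_card_of_injective (fun w => ⟨w.1, w.2.2⟩) fun w w' h => ?_)
  · have := Nat.card_le_card_of_injective
      (f := fun w : {w // (e.symm (p w)).val < k ∧ q w = y} =>
        (⟨(e.symm (p w.1)).val, w.2.1⟩ : Fin k)) fun w w' h => ?_
    · simpa using this
    · refine Subtype.ext (hinj _ _ ?_ (w.2.2.trans w'.2.2.symm))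
      exact e.symm.injective (Fin.ext (Fin.mk.inj_iff.1 h))
  · exact Subtype.ext (congrArg (fun z : {w // q w = y} => z.1) h)

/-- Both sides count the boxes in the first `k` columns of the diagram of `ν`, by rows and by
columns. -/
theorem sum_min_eq [Fintype Y] {q : W → Y} (e : Fin ν.rowLens.length ≃ Y)
    (he : ∀ i, ν.rowLens.get i = Nat.card {w // q w = e i}) (k : ℕ) :
    ∑ y, min k (Nat.card {w // q w = y}) = ∑ j ∈ Finset.range k, ν.transpose.rowLen j := by
  classical
  have h1 : ∀ c, min k c = ∑ j ∈ Finset.range k, if j < c then 1 else 0 := by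
    intro c
    rw [Finset.sum_boole, Nat.cast_id, ← Finset.card_range (min k c)]
    congr 1
    ext j
    simp
  simp_rw [h1]
  rw [Finset.sum_comm]
  refine Finset.sum_congr rfl fun j _ => ?_
  rw [YoungDiagram.rowLen_transpose, colLen_eq_card_columns e he, Finset.sum_boole, Nat.cast_id,
    Nat.card_eq_fintype_card, Fintype.card_subtype]

theorem card_lt_eq_sum [Finite W] [Fintype Y] {p : W → X} {q : W → Y} (e : Fin μ.rowLens.length ≃ X) (k : ℕ) :
    Nat.card {w // (e.symm (p w)).val < k} =
      ∑ y, Nat.card {w // (e.symm (p w)).val < k ∧ q w = y} := by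
  classical
  have := Fintype.ofFinite W
  rw [Nat.card_eq_fintype_card, Fintype.card_subtype,
    Finset.card_eq_sum_card_fiberwise (f := q) (t := Finset.univ) (fun w _ => Finset.mem_univ _)]
  refine Finset.sum_congr rfl fun y _ => ?_
  rw [Nat.card_eq_fintype_card, Fintype.card_subtype, Finset.filter_filter]

/-- The row sums of a zero-one matrix are dominated by the conjugate of the column sums. -/
theorem rowLens_le_transpose [Finite W] {p : W → X} {q : W → Y} (e : Fin μ.rowLens.length ≃ X)
    (he : ∀ i, μ.rowLens.get i = Nat.card {w // p w = e i}) (e' : Fin ν.rowLens.length ≃ Y)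
    (he' : ∀ i, ν.rowLens.get i = Nat.card {w // q w = e' i})
    (hinj : ∀ w w', p w = p w' → q w = q w' → w = w') :
    μ.rowLens ≤ ν.transpose.rowLens := by
  have := Fintype.ofEquiv _ e'
  refine rowLens_le_of_dominance fun k => ?_
  rw [sum_rowLen_eq e he, card_lt_eq_sum (q := q) e, ← sum_min_eq e' he']
  exact Finset.sum_le_sum fun y _ => card_fiber_lt_le e hinj k y

/-- A zero-one matrix whose row sums are conjugate to the column sums is determined by them. -/
theorem exists_entry_iff [Finite W] {p : W → X} {q : W → Y} (e : Fin μ.rowLens.length ≃ X)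
    (he : ∀ i, μ.rowLens.get i = Nat.card {w // p w = e i}) (e' : Fin ν.rowLens.length ≃ Y)
    (he' : ∀ i, ν.rowLens.get i = Nat.card {w // q w = e' i})
    (hinj : ∀ w w', p w = p w' → q w = q w' → w = w') (hμ : μ = ν.transpose) (x : X) (y : Y) :
    (∃ w, p w = x ∧ q w = y) ↔ (e.symm x).val < Nat.card {w // q w = y} := by
  have := Fintype.ofEquiv _ e'
  -- Conjugate sums force equality in every dominance inequality, hence in each column bound: every
  -- column fills its topmost rows.
  have key : ∀ k y, Nat.card {w // (e.symm (p w)).val < k ∧ q w = y} =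
      min k (Nat.card {w // q w = y}) := by
    intro k y
    have h1 : ∑ y, Nat.card {w // (e.symm (p w)).val < k ∧ q w = y} =
        ∑ y, min k (Nat.card {w // q w = y}) := by
      rw [← card_lt_eq_sum (q := q) e, ← sum_rowLen_eq e he, sum_min_eq e' he', hμ]
    exact (Finset.sum_eq_sum_iff_of_le fun y _ => card_fiber_lt_le e hinj k y).1 h1 y
      (Finset.mem_univ y)
  constructor
  · rintro ⟨w, rfl, rfl⟩
    by_contra hlt
    -- Taking `k` equal to the column sum shows that the whole column lies in its first `k` rows.
    have h1 := key (Nat.card {w' // q w' = q w}) (q w)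
    rw [min_self] at h1
    have h2 := Function.Injective.bijective_of_nat_card_le
      (f := fun z : {w' // (e.symm (p w')).val < Nat.card {w' // q w' = q w} ∧ q w' = q w} =>
        (⟨z.1, z.2.2⟩ : {w' // q w' = q w}))
      (fun z z' h => Subtype.ext (congrArg (fun z : {w' // q w' = q w} => z.1) h)) h1.ge
    obtain ⟨z, hz⟩ := h2.2 ⟨w, rfl⟩
    have h3 : z.1 = w := congrArg (fun z : {w' // q w' = q w} => z.1) hz
    have h4 := z.2.1
    rw [h3] at h4
    exact hlt h4
  · intro hlt
    by_contra hne
    -- The counts for `k` and `k + 1` differ when `k` is less than the column sum, so row `k` has an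
    -- entry.
    have h1 := key (e.symm x).val y
    have h2 := key ((e.symm x).val + 1) y
    have h3 : Nat.card {w // (e.symm (p w)).val < (e.symm x).val ∧ q w = y} =
        Nat.card {w // (e.symm (p w)).val < (e.symm x).val + 1 ∧ q w = y} := by
      refine Nat.card_congr (Equiv.subtypeEquivRight fun w =>
        and_congr_left fun hw => ⟨fun h => by omega, fun h => ?_⟩)
      refine lt_of_le_of_ne (by omega) fun h4 => hne ⟨w, ?_, hw⟩
      exact e.symm.injective (Fin.ext h4)
    omega

end GaleRyser

/-! ### Comparison of sets of keys -/

section Comparison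

variable {V C D : Type*} [Fintype V] [LinearOrder C] [LinearOrder D]

/-- Equal fibre sizes above `m` give the two strict superlevel sets the same cardinality, and one
contains the other. -/
theorem gt_iff_gt_of_card_eq {f g : V → C} (hle : ∀ t, f t ≤ g t) {m : C}
    (h : ∀ m', m < m' → Nat.card {t // f t = m'} = Nat.card {t // g t = m'}) (t : V) :
    m < f t ↔ m < g t := by
  classical
  have hcard : ∀ f : V → C, (Finset.univ.filter fun t => m < f t).card =
      ∑ m' ∈ ((Finset.univ.image f).filter (m < ·)), Nat.card {t // f t = m'} := by
    intro f
    rw [Finset.card_eq_sum_card_fiberwise (f := f) (t := (Finset.univ.image f).filter (m < ·))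
      (fun t ht => by simpa using ht)]
    refine Finset.sum_congr rfl fun m' hm' => ?_
    rw [Nat.card_eq_fintype_card, Fintype.card_subtype, Finset.filter_filter]
    congr 1
    ext t
    simp only [Finset.mem_filter, Finset.mem_univ, true_and]
    exact ⟨fun h => h.2, fun h => ⟨h ▸ (Finset.mem_filter.1 hm').2, h⟩⟩
  have himage : (Finset.univ.image f).filter (m < ·) = (Finset.univ.image g).filter (m < ·) := by
    ext m'
    simp only [Finset.mem_filter, Finset.mem_image, Finset.mem_univ, true_and]
    refine and_congr_left fun hm' => ?_
    have h1 : ∀ f : V → C, (∃ t, f t = m') ↔ 0 < Nat.card {t // f t = m'} := fun f => by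
      rw [Nat.card_pos_iff, nonempty_subtype]
      exact ⟨fun h => ⟨h, inferInstance⟩, fun h => h.1⟩
    rw [h1, h1, h m' hm']
  have hsub : (Finset.univ.filter fun t => m < f t) ⊆ Finset.univ.filter fun t => m < g t :=
    fun t ht => by
      simp only [Finset.mem_filter, Finset.mem_univ, true_and] at ht ⊢
      exact ht.trans_le (hle t)
  have heq := Finset.eq_of_subset_of_card_le hsub (by
    rw [hcard, hcard, himage]
    exact (Finset.sum_congr rfl fun m' hm' => h m' (Finset.mem_filter.1 hm').2).ge)
  have := Finset.ext_iff.1 heq t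
  simpa using this

/-- If `B` were smaller, let `k t₀` be the greatest difference and `m` its first component. Above
`m` the key sets agree, so by `hcard` the superlevel sets of the first components agree, and the
class of `m` for `k` lies in the class for `l`. Then `hkl` gives `k t₀ ≤ l t₀`, and either case
contradicts the choice of `k t₀`. -/
theorem toColex_le_of_enumeration {k l : V → C ×ₗ D} {A B : Finset (C ×ₗ D)}
    (hA : ∀ x, x ∈ A ↔ ∃ t, k t = x) (hB : ∀ x, x ∈ B ↔ ∃ t, l t = x)
    (hle : ∀ t, (ofLex (k t)).1 ≤ (ofLex (l t)).1)
    (hk : ∀ t t', (ofLex (k t)).1 = (ofLex (k t')).1 → k t = k t')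
    (hl : ∀ t t', (ofLex (l t)).1 = (ofLex (l t')).1 → l t = l t')
    (hkl : ∀ t, (ofLex (k t)).1 = (ofLex (l t)).1 →
      (∀ t', (ofLex (k t')).1 = (ofLex (k t)).1 → (ofLex (l t')).1 = (ofLex (k t)).1) → k t ≤ l t)
    (hcard : ∀ t t', k t = l t' → Nat.card {s // (ofLex (k s)).1 = (ofLex (k t)).1} =
      Nat.card {s // (ofLex (l s)).1 = (ofLex (k t)).1}) :
    toColex A ≤ toColex B ∧ (A = B → ∀ t, k t = l t) := by
  have hcard' : ∀ m, (∀ t, (ofLex (k t)).1 = m → ∃ t', k t = l t') →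
      (∀ t', (ofLex (l t')).1 = m → ∃ t, k t = l t') →
      Nat.card {s // (ofLex (k s)).1 = m} = Nat.card {s // (ofLex (l s)).1 = m} := by
    intro m h1 h2
    by_cases h3 : ∃ t, (ofLex (k t)).1 = m
    · obtain ⟨t, rfl⟩ := h3
      obtain ⟨t', ht'⟩ := h1 t rfl
      exact hcard t t' ht'
    · have h4 : ¬ ∃ t, (ofLex (l t)).1 = m := by
        rintro ⟨t', ht'⟩
        obtain ⟨t, ht⟩ := h2 t' ht'
        exact h3 ⟨t, by rw [ht, ht']⟩
      push Not at h3 h4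
      have : IsEmpty {s // (ofLex (k s)).1 = m} := ⟨fun s => h3 s.1 s.2⟩
      have : IsEmpty {s // (ofLex (l s)).1 = m} := ⟨fun s => h4 s.1 s.2⟩
      rw [Nat.card_of_isEmpty, Nat.card_of_isEmpty]
  constructor
  · by_contra hlt
    obtain ⟨w, hw, hw', h⟩ := exists_greatest_difference_of_colex_lt (not_le.1 hlt)
    obtain ⟨t₀, rfl⟩ := (hA _).1 hw
    simp only [hA, hB, not_exists] at hw' h
    have hfg : ∀ t, (ofLex (k t₀)).1 < (ofLex (k t)).1 ↔ (ofLex (k t₀)).1 < (ofLex (l t)).1 := by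
      refine gt_iff_gt_of_card_eq hle fun m hm => hcard' m ?_ ?_
      · rintro t rfl
        obtain ⟨t', ht'⟩ := (h (k t) (Prod.Lex.lt_iff.2 (Or.inl hm))).2 ⟨t, rfl⟩
        exact ⟨t', ht'.symm⟩
      · rintro t' rfl
        exact (h (l t') (Prod.Lex.lt_iff.2 (Or.inl hm))).1 ⟨t', rfl⟩
    have hsub : ∀ t, (ofLex (k t)).1 = (ofLex (k t₀)).1 → (ofLex (l t)).1 = (ofLex (k t₀)).1 :=
      fun t ht => le_antisymm (not_lt.1 fun h1 => ((hfg t).2 h1).ne' ht) (ht ▸ hle t)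
    rcases (hkl t₀ (hsub t₀ rfl).symm hsub).eq_or_lt with h1 | h1
    · exact hw' t₀ h1.symm
    · obtain ⟨t, ht⟩ := (h (l t₀) h1).1 ⟨t₀, rfl⟩
      -- The larger key `l t₀` also lies in `A` and has first component `m`; but `A` has only one
      -- key with that component.
      have h2 : k t = k t₀ := hk _ _ (by rw [ht, hsub t₀ rfl])
      exact h1.ne (h2.symm.trans ht)
  · intro heq
    have h1 : ∀ t, ∃ t', k t = l t' := fun t => by
      obtain ⟨t', ht'⟩ := (hB _).1 (heq ▸ (hA (k t)).2 ⟨t, rfl⟩)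
      exact ⟨t', ht'.symm⟩
    have h2 : ∀ t', ∃ t, k t = l t' := fun t' => (hA _).1 (heq ▸ (hB (l t')).2 ⟨t', rfl⟩)
    have h3 : ∀ m t, m < (ofLex (k t)).1 ↔ m < (ofLex (l t)).1 := fun m =>
      gt_iff_gt_of_card_eq hle fun m' _ => hcard' m' (fun t _ => h1 t) (fun t _ => h2 t)
    intro t
    obtain ⟨t', ht'⟩ := h1 t
    rw [ht']
    refine hl _ _ ?_
    rw [← ht']
    exact le_antisymm (hle t) (not_lt.1 fun h4 => lt_irrefl _ ((h3 _ t).2 h4))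

end Comparison

/-! ### Comparison of a composition with a transpose -/

section Main

/-- The labeling with the conjugate partitions. -/
abbrev Labeling.transpose (Ξ : Labeling.{u}) : Labeling.{u} where
  tree := Ξ.tree
  label a := (Ξ.label a).transpose

theorem Labeling.Good.transpose {Ξ : Labeling.{u}} (h : Ξ.Good) : Ξ.transpose.Good := by
  intro a c c' hc hc' h'
  refine h a c c' hc hc' ?_
  rcases h' with h1 | ⟨h1, h2, h3⟩
  · exact Or.inl h1
  · obtain ⟨γ, hγ⟩ := Labeling.sub_iso_sub_iff.1 h3
    exact Or.inr ⟨h1, h2, Labeling.sub_iso_sub_iff.2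
      ⟨γ, fun s hs => YoungDiagram.transpose_eq_iff.1 (hγ s hs)⟩⟩

/-- Distinct siblings in the same fibres are not related by an isomorphism of their subtrees
compatible with both homomorphisms. -/
def JointlySeparated {T P M : RootedTree.{u}} (φ : TreeHom T P) (ψ : TreeHom T M) : Prop :=
  ∀ v w : T, DistinctSiblings v w → φ v = φ w → ψ v = ψ w → ∀ ζ : sub T v ≃o sub T w,
    ¬ ∀ t : sub T v, φ (ζ t) = φ t ∧ ψ (ζ t) = ψ t

/-- When `ρ` is an isomorphism, conjugating `ζ` by it supplies the isomorphism of subtrees of `R`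
that coarseness excludes. -/
theorem TrivialCoarsestCommonRefinement.jointlySeparated {T P M : RootedTree.{u}}
    {φ : TreeHom T P} {ψ : TreeHom T M} (h : TrivialCoarsestCommonRefinement φ ψ) :
    JointlySeparated φ ψ := by
  obtain ⟨R, ρ, θ, τ, hR, e, he⟩ := h
  intro v w ⟨hne, p, hpv, hpw⟩ hφ hψ ζ hζ
  have hθ : ∀ t, θ (e t) = φ t := fun t => by rw [he, hR.comm_left]
  have hτ : ∀ t, τ (e t) = ψ t := fun t => by rw [he, hR.comm_right]
  let ε : ∀ v : T, sub T v ≃o sub R (ρ v) := fun v =>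
    (isoRestrict e v).trans (subIsoCast (he v))
  have hε : ∀ (v : T) (t : sub T v), ε v t = ρ.restr v t := fun v t => Subtype.ext (he t)
  have hε' : ∀ (v : T) (t : sub T v), (ε v t : R) = e t := fun v t => rfl
  let γ := ((ε v).symm.trans ζ).trans (ε w)
  have hγ : ∀ t, γ (ε v t) = ε w (ζ t) := fun t => by
    change ε w (ζ ((ε v).symm (ε v t))) = _
    rw [OrderIso.symm_apply_apply]
  refine hR.coarse (ρ v) (ρ w) ⟨fun h => hne ?_, ρ p, ρ.map_covBy _ _ hpv, ρ.map_covBy _ _ hpw⟩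
    (by rw [hR.comm_left, hR.comm_left, hφ]) (by rw [hR.comm_right, hR.comm_right, hψ]) v w rfl rfl
    ⟨ζ, γ, fun t => (hζ t).1, fun t => (hζ t).2, fun t => ?_,
      fun r => ?_, fun r => ?_⟩
  · rw [← he, ← he] at h
    exact e.injective h
  · rw [← hε, ← hε, hγ]
  · obtain ⟨t, rfl⟩ := (ε v).surjective r
    rw [hγ, hε', hε', hθ, hθ]
    exact (hζ t).1
  · obtain ⟨t, rfl⟩ := (ε v).surjective r
    rw [hγ, hε', hε', hτ, hτ]
    exact (hζ t).2

variable {T P M : RootedTree.{u}}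

/-- An enumeration of the parts made at `v` serves every `w` with the same image, so the matrices at
`v` and `w` share their indices. The predicate `S` lets one set of entries, described through `φ`,
be used for `ψ` too. -/
theorem rows_card {Q : RootedTree.{u}} {φ : TreeHom T P} {α : TreeHom P Q}
    (hφ : IsComposition φ) {v w : T} (h : φ v = φ w) {c : Q} {μ : YoungDiagram}
    {e : Fin μ.rowLens.length ≃ {y : P // φ v ⋖ y ∧ α y = c}}
    (he : ∀ i, μ.rowLens.get i = Nat.card {t : T // v ⋖ t ∧ φ t = (e i).1}) {S : T → Prop}
    (hS : ∀ t, w ⋖ t → (S t ↔ α (φ t) = c))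
    (p : {t // w ⋖ t ∧ S t} → {y : P // φ v ⋖ y ∧ α y = c}) (hp : ∀ t, (p t).1 = φ t.1)
    (i : Fin μ.rowLens.length) : μ.rowLens.get i = Nat.card {t // p t = e i} := by
  rw [he, hφ.card_children_eq h]
  refine Nat.card_congr ⟨fun t => ⟨⟨t.1, t.2.1, ?_⟩, Subtype.ext ?_⟩,
    fun t => ⟨t.1.1, t.1.2.1, ?_⟩, fun _ => rfl, fun _ => rfl⟩
  · rw [hS _ t.2.1, t.2.2]
    exact (e i).2.2
  · rw [hp]
    exact t.2.2
  · rw [← hp, t.2]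

theorem IsTypeLabel.card_eq [Finite T] {Q : RootedTree.{u}} {φ : TreeHom T P} {α : TreeHom P Q}
    {lab : Q → YoungDiagram} (hφ : IsComposition φ) (h : IsTypeLabel φ α lab) {v : T} {c : Q}
    (hc : α (φ v) ⋖ c) : (lab c).card = Nat.card {t : T // v ⋖ t ∧ α (φ t) = c} := by
  obtain ⟨e, he⟩ := h v c hc
  exact card_eq_card_of_rows (p := fun t : {t : T // v ⋖ t ∧ α (φ t) = c} =>
    (⟨φ t.1, φ.map_covBy _ _ t.2.1, t.2.2⟩ : {y : P // φ v ⋖ y ∧ α y = c})) e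
    (rows_card hφ rfl he (fun _ _ => Iff.rfl) _ fun _ => rfl)

theorem fst_key_eq_bot {Λ : Labeling.{u}} [Finite Λ.tree] {n : ℕ} {c : Λ.tree} :
    (ofLex (Λ.key n c)).1 = ⊥ ↔ IsLeaf c := by
  rcases isLeaf_or_isInternal c with h | h
  · rw [key_of_isLeaf h]
    exact iff_of_true rfl h
  · rw [key_of_isInternal h]
    exact iff_of_false WithBot.coe_ne_bot (not_isLeaf_iff.2 h)

/-- Two compositions with their trees of partitions, without nontrivial common refinements. -/
structure SeparatedPair (φ : TreeHom T P) (ψ : TreeHom T M) {Λ Ξ : Labeling.{u}}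
    (α : TreeHom P Λ.tree) (β : TreeHom M Ξ.tree) : Prop where
  left : IsComposition φ
  right : IsComposition ψ
  quotient_left : IsQuotient φ α
  quotient_right : IsQuotient ψ β
  label_left : IsTypeLabel φ α Λ.label
  label_right : IsTypeLabel ψ β Ξ.label
  separated : JointlySeparated φ ψ

namespace SeparatedPair

variable {φ : TreeHom T P} {ψ : TreeHom T M} {Λ Ξ : Labeling.{u}} {α : TreeHom P Λ.tree}
  {β : TreeHom M Ξ.tree}

theorem isLeaf_left (h : SeparatedPair φ ψ α β) (t : T) : IsLeaf (α (φ t)) ↔ IsLeaf t := by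
  rw [h.quotient_left.composition.isLeaf_iff, h.left.isLeaf_iff]

theorem isLeaf_right (h : SeparatedPair φ ψ α β) (t : T) : IsLeaf (β (ψ t)) ↔ IsLeaf t := by
  rw [h.quotient_right.composition.isLeaf_iff, h.right.isLeaf_iff]

theorem heightLE_left (h : SeparatedPair φ ψ α β) {n : ℕ} (t : T) :
    HeightLE n (α (φ t)) ↔ HeightLE n t := by
  rw [h.quotient_left.composition.heightLE_iff, h.left.heightLE_iff]

theorem heightLE_right (h : SeparatedPair φ ψ α β) {n : ℕ} (t : T) :
    HeightLE n (β (ψ t)) ↔ HeightLE n t := by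
  rw [h.quotient_right.composition.heightLE_iff, h.right.heightLE_iff]

theorem exists_iso_of_isLeaf (h : SeparatedPair φ ψ α β) {v w : T} (hv : IsLeaf v)
    (hφ : φ v = φ w) (hψ : ψ v = ψ w) :
    ∃ ζ : sub T v ≃o sub T w, ∀ t : sub T v, φ (ζ t) = φ t ∧ ψ (ζ t) = ψ t := by
  have hw : IsLeaf w := by
    rw [← h.left.isLeaf_iff, ← hφ, h.left.isLeaf_iff]; exact hv
  refine ⟨leafIso hv hw, fun t => ?_⟩
  rw [hv.eq_of_le t.2]
  exact ⟨hφ.symm, hψ.symm⟩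

theorem mem_keys_left [Finite Λ.tree] (h : SeparatedPair φ ψ α β) (n : ℕ) (v : T) (k : Key n) :
    k ∈ Λ.keys n (α (φ v)) ↔ ∃ t : {t // v ⋖ t}, Λ.key n (α (φ t)) = k := by
  rw [Labeling.mem_keys]
  constructor
  · rintro ⟨c, hc, rfl⟩
    obtain ⟨t, ht, rfl⟩ := h.quotient_left.exists_child h.left hc
    exact ⟨⟨t, ht⟩, rfl⟩
  · rintro ⟨t, rfl⟩
    exact ⟨_, α.map_covBy _ _ (φ.map_covBy _ _ t.2), rfl⟩

theorem mem_keys_right [Finite Ξ.tree] (h : SeparatedPair φ ψ α β) (n : ℕ) (v : T) (k : Key n) :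
    k ∈ Ξ.transpose.keys n (β (ψ v)) ↔
      ∃ t : {t // v ⋖ t}, Ξ.transpose.key n (β (ψ t)) = k := by
  rw [Labeling.mem_keys]
  constructor
  · rintro ⟨c, hc, rfl⟩
    obtain ⟨t, ht, rfl⟩ := h.quotient_right.exists_child h.right hc
    exact ⟨⟨t, ht⟩, rfl⟩
  · rintro ⟨t, rfl⟩
    exact ⟨_, β.map_covBy _ _ (ψ.map_covBy _ _ t.2), rfl⟩

/-- The comparison of the codes of the two labelings at a given height. -/
def CodeLE [Finite Λ.tree] [Finite Ξ.tree] (_ : SeparatedPair φ ψ α β) (n : ℕ) : Prop :=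
  ∀ v : T, HeightLE n v → Λ.code n (α (φ v)) ≤ Ξ.transpose.code n (β (ψ v))

/-- Equality of the codes determines the pair of compositions. -/
def CodeRigid [Finite Λ.tree] [Finite Ξ.tree] (_ : SeparatedPair φ ψ α β) (n : ℕ) : Prop :=
  ∀ v w : T, HeightLE n v → φ v = φ w → ψ v = ψ w →
    Λ.code n (α (φ v)) = Ξ.transpose.code n (β (ψ v)) →
    ∃ ζ : sub T v ≃o sub T w, ∀ t : sub T v, φ (ζ t) = φ t ∧ ψ (ζ t) = ψ t

theorem exists_iso_of_key_eq [Finite Λ.tree] [Finite Ξ.tree]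
    (h : SeparatedPair φ ψ α β) {n : ℕ} (hn : h.CodeRigid n) {v w : T}
    (hv : HeightLE n v) (hφ : φ v = φ w) (hψ : ψ v = ψ w)
    (hk : (ofLex (Λ.key n (α (φ v)))).1 = (ofLex (Ξ.transpose.key n (β (ψ v)))).1) :
    ∃ ζ : sub T v ≃o sub T w, ∀ t : sub T v, φ (ζ t) = φ t ∧ ψ (ζ t) = ψ t := by
  rcases isLeaf_or_isInternal v with hl | hi
  · exact h.exists_iso_of_isLeaf hl hφ hψ
  · refine hn v w hv hφ hψ ?_
    rw [key_of_isInternal (α.isInternal_map (φ.isInternal_map hi)),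
      key_of_isInternal (Λ := Ξ.transpose) (β.isInternal_map (ψ.isInternal_map hi))] at hk
    exact WithBot.coe_inj.1 hk

/-- This is the zero-one property: rigidity would give two children in one cell isomorphic subtrees
over both maps, against separation. -/
theorem children_injective [Finite Λ.tree] [Finite Ξ.tree] (h : SeparatedPair φ ψ α β) {n : ℕ} (hn : h.CodeRigid n) {v s s' : T}
    (hv : HeightLE (n + 1) v) (hs : v ⋖ s) (hs' : v ⋖ s') (hφ : φ s = φ s') (hψ : ψ s = ψ s')
    (hk : (ofLex (Λ.key n (α (φ s)))).1 = (ofLex (Ξ.transpose.key n (β (ψ s)))).1) : s = s' := by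
  by_contra hne
  obtain ⟨ζ, hζ⟩ := h.exists_iso_of_key_eq hn (hv s hs) hφ hψ hk
  exact h.separated s s' ⟨hne, v, hs, hs'⟩ hφ hψ ζ hζ

variable [Finite T]

theorem rowLens_le (h : SeparatedPair φ ψ α β) {v t : T} (ht : v ⋖ t)
    (hS : ∀ s, v ⋖ s → (α (φ s) = α (φ t) ↔ β (ψ s) = β (ψ t)))
    (hinj : ∀ s s', v ⋖ s → v ⋖ s' → α (φ s) = α (φ t) → φ s = φ s' → ψ s = ψ s' → s = s') :
    (Λ.label (α (φ t))).rowLens ≤ (Ξ.label (β (ψ t))).transpose.rowLens := by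
  obtain ⟨e, he⟩ := h.label_left v _ (α.map_covBy _ _ (φ.map_covBy _ _ ht))
  obtain ⟨e', he'⟩ := h.label_right v _ (β.map_covBy _ _ (ψ.map_covBy _ _ ht))
  let p : {s : T // v ⋖ s ∧ α (φ s) = α (φ t)} → {y : P // φ v ⋖ y ∧ α y = α (φ t)} :=
    fun s => ⟨φ s.1, φ.map_covBy _ _ s.2.1, s.2.2⟩
  let q : {s : T // v ⋖ s ∧ α (φ s) = α (φ t)} → {z : M // ψ v ⋖ z ∧ β z = β (ψ t)} :=
    fun s => ⟨ψ s.1, ψ.map_covBy _ _ s.2.1, (hS _ s.2.1).1 s.2.2⟩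
  exact rowLens_le_transpose e (rows_card h.left rfl he (fun _ _ => Iff.rfl) p fun _ => rfl) e'
    (rows_card h.right rfl he' hS q fun _ => rfl) fun s s' h1 h2 => Subtype.ext
      (hinj _ _ s.2.1 s'.2.1 s.2.2 (congrArg Subtype.val h1) (congrArg Subtype.val h2))

/-- The matrices at `v` and `w` have the same row and column sums. These are conjugate, so both
matrices have their entries in the same cells. -/
theorem exists_corresponding_child (h : SeparatedPair φ ψ α β) {v w t : T} (ht : v ⋖ t)
    (hφ : φ v = φ w) (hψ : ψ v = ψ w)
    (hS : ∀ s, v ⋖ s ∨ w ⋖ s → (α (φ s) = α (φ t) ↔ β (ψ s) = β (ψ t)))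
    (hinj : ∀ s s', (v ⋖ s ∧ v ⋖ s') ∨ (w ⋖ s ∧ w ⋖ s') → α (φ s) = α (φ t) → φ s = φ s' →
      ψ s = ψ s' → s = s')
    (hlab : Λ.label (α (φ t)) = (Ξ.label (β (ψ t))).transpose) :
    ∃ t', w ⋖ t' ∧ φ t' = φ t ∧ ψ t' = ψ t := by
  obtain ⟨e, he⟩ := h.label_left v _ (α.map_covBy _ _ (φ.map_covBy _ _ ht))
  obtain ⟨e', he'⟩ := h.label_right v _ (β.map_covBy _ _ (ψ.map_covBy _ _ ht))
  let X := {y : P // φ v ⋖ y ∧ α y = α (φ t)}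
  let Y := {z : M // ψ v ⋖ z ∧ β z = β (ψ t)}
  let p₁ : {s : T // v ⋖ s ∧ α (φ s) = α (φ t)} → X := fun s =>
    ⟨φ s.1, φ.map_covBy _ _ s.2.1, s.2.2⟩
  let q₁ : {s : T // v ⋖ s ∧ α (φ s) = α (φ t)} → Y := fun s =>
    ⟨ψ s.1, ψ.map_covBy _ _ s.2.1, (hS _ (Or.inl s.2.1)).1 s.2.2⟩
  let p₂ : {s : T // w ⋖ s ∧ α (φ s) = α (φ t)} → X := fun s =>
    ⟨φ s.1, hφ ▸ φ.map_covBy _ _ s.2.1, s.2.2⟩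
  let q₂ : {s : T // w ⋖ s ∧ α (φ s) = α (φ t)} → Y := fun s =>
    ⟨ψ s.1, hψ ▸ ψ.map_covBy _ _ s.2.1, (hS _ (Or.inr s.2.1)).1 s.2.2⟩
  have hp₁ := rows_card h.left rfl he (fun _ _ => Iff.rfl) p₁ fun _ => rfl
  have hp₂ := rows_card h.left hφ he (fun _ _ => Iff.rfl) p₂ fun _ => rfl
  have hq₁ := rows_card h.right rfl he' (fun s hs => hS s (Or.inl hs)) q₁ fun _ => rfl
  have hq₂ := rows_card h.right hψ he' (fun s hs => hS s (Or.inr hs)) q₂ fun _ => rfl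
  have h1 := (exists_entry_iff e hp₁ e' hq₁ (fun s s' h1 h2 => Subtype.ext
    (hinj _ _ (Or.inl ⟨s.2.1, s'.2.1⟩) s.2.2 (congrArg Subtype.val h1) (congrArg Subtype.val h2)))
    hlab (p₁ ⟨t, ht, rfl⟩) (q₁ ⟨t, ht, rfl⟩)).1 ⟨_, rfl, rfl⟩
  obtain ⟨i, hi⟩ := e'.surjective (q₁ ⟨t, ht, rfl⟩)
  rw [← hi, ← hq₁, hq₂, hi] at h1
  obtain ⟨s, hs, hs'⟩ := (exists_entry_iff e hp₂ e' hq₂ (fun s s' h1 h2 => Subtype.ext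
    (hinj _ _ (Or.inr ⟨s.2.1, s'.2.1⟩) s.2.2 (congrArg Subtype.val h1) (congrArg Subtype.val h2)))
    hlab _ _).2 h1
  exact ⟨s.1, s.2.1, congrArg Subtype.val hs, congrArg Subtype.val hs'⟩

theorem good_left (h : SeparatedPair φ ψ α β) : Λ.Good :=
  h.quotient_left.good h.left h.label_left

theorem good_right (h : SeparatedPair φ ψ α β) : Ξ.transpose.Good :=
  (h.quotient_right.good h.right h.label_right).transpose

theorem left_eq_iff [Finite Λ.tree] (h : SeparatedPair φ ψ α β) {n : ℕ} {v w s t : T} (hv : HeightLE (n + 1) v)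
    (hvw : φ v = φ w) (ht : v ⋖ t) (hs : w ⋖ s) :
    (ofLex (Λ.key n (α (φ s)))).1 = (ofLex (Λ.key n (α (φ t)))).1 ↔ α (φ s) = α (φ t) :=
  ⟨fun h1 => h.good_left.key_injective ((h.heightLE_left v).2 hv)
    (hvw ▸ α.map_covBy _ _ (φ.map_covBy _ _ hs)) (α.map_covBy _ _ (φ.map_covBy _ _ ht)) h1,
    fun h1 => by rw [h1]⟩

theorem right_eq_iff [Finite Ξ.tree] (h : SeparatedPair φ ψ α β) {n : ℕ} {v w s t : T} (hv : HeightLE (n + 1) v)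
    (hvw : ψ v = ψ w) (ht : v ⋖ t) (hs : w ⋖ s) :
    (ofLex (Ξ.transpose.key n (β (ψ s)))).1 = (ofLex (Ξ.transpose.key n (β (ψ t)))).1 ↔
      β (ψ s) = β (ψ t) :=
  ⟨fun h1 => h.good_right.key_injective ((h.heightLE_right v).2 hv)
    (hvw ▸ β.map_covBy _ _ (ψ.map_covBy _ _ hs)) (β.map_covBy _ _ (ψ.map_covBy _ _ ht)) h1,
    fun h1 => by rw [h1]⟩

theorem card_left [Finite Λ.tree] (h : SeparatedPair φ ψ α β) {n : ℕ} {v t : T} (hv : HeightLE (n + 1) v)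
    (ht : v ⋖ t) : Nat.card {s : {s // v ⋖ s} // (ofLex (Λ.key n (α (φ s)))).1 =
      (ofLex (Λ.key n (α (φ t)))).1} = (Λ.label (α (φ t))).card := by
  rw [h.label_left.card_eq h.left (α.map_covBy _ _ (φ.map_covBy _ _ ht))]
  refine Nat.card_congr ((Equiv.subtypeEquivRight fun s => ?_).trans
    (Equiv.subtypeSubtypeEquivSubtypeInter (fun s => v ⋖ s) fun s => α (φ s) = α (φ t)))
  exact h.left_eq_iff hv rfl ht s.2

theorem card_right [Finite Ξ.tree] (h : SeparatedPair φ ψ α β) {n : ℕ} {v t : T} (hv : HeightLE (n + 1) v)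
    (ht : v ⋖ t) : Nat.card {s : {s // v ⋖ s} // (ofLex (Ξ.transpose.key n (β (ψ s)))).1 =
      (ofLex (Ξ.transpose.key n (β (ψ t)))).1} = (Ξ.label (β (ψ t))).transpose.card := by
  rw [transpose_card, h.label_right.card_eq h.right (β.map_covBy _ _ (ψ.map_covBy _ _ ht))]
  refine Nat.card_congr ((Equiv.subtypeEquivRight fun s => ?_).trans
    (Equiv.subtypeSubtypeEquivSubtypeInter (fun s => v ⋖ s) fun s => β (ψ s) = β (ψ t)))
  exact h.right_eq_iff hv rfl ht s.2

variable [Finite Λ.tree] [Finite Ξ.tree]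

/-- By `hsub` the class of `t` for `φ` lies in its class for `ψ`. For internal vertices a proper
inclusion is decided by the sizes; if the classes coincide, as they always do for leaves, they form
a zero-one matrix and the Gale–Ryser bound applies. -/
theorem key_le_key (h : SeparatedPair φ ψ α β) {n : ℕ} (hn : h.CodeRigid n) {v t : T}
    (hv : HeightLE (n + 1) v) (ht : v ⋖ t)
    (hk : (ofLex (Λ.key n (α (φ t)))).1 = (ofLex (Ξ.transpose.key n (β (ψ t)))).1)
    (hsub : ∀ s, v ⋖ s → (ofLex (Λ.key n (α (φ s)))).1 = (ofLex (Λ.key n (α (φ t)))).1 →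
      (ofLex (Ξ.transpose.key n (β (ψ s)))).1 = (ofLex (Λ.key n (α (φ t)))).1) :
    Λ.key n (α (φ t)) ≤ Ξ.transpose.key n (β (ψ t)) := by
  have hsub' : ∀ s, v ⋖ s → α (φ s) = α (φ t) → β (ψ s) = β (ψ t) := fun s hs h1 =>
    (h.right_eq_iff hv rfl ht hs).1 ((hsub s hs ((h.left_eq_iff hv rfl ht hs).2 h1)).trans hk)
  have hrow : (∀ s, v ⋖ s → β (ψ s) = β (ψ t) → α (φ s) = α (φ t)) →
      (Λ.label (α (φ t))).rowLens ≤ (Ξ.label (β (ψ t))).transpose.rowLens := by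
    intro hsup
    refine h.rowLens_le ht (fun s hs => ⟨hsub' s hs, hsup s hs⟩) fun s s' hs hs' h1 h2 h3 => ?_
    refine h.children_injective hn hv hs hs' h2 h3 ?_
    rw [h1, hsub' s hs h1, hk]
  rcases isLeaf_or_isInternal t with hl | hi
  · rw [key_of_isLeaf ((h.isLeaf_left t).2 hl),
      key_of_isLeaf (Λ := Ξ.transpose) ((h.isLeaf_right t).2 hl), Prod.Lex.toLex_le_toLex,
      Prod.Lex.toLex_le_toLex]
    refine Or.inr ⟨rfl, Or.inr ⟨rfl, hrow fun s hs h1 => ?_⟩⟩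
    have hs' : IsLeaf s := (h.isLeaf_right s).1 (h1 ▸ (h.isLeaf_right t).2 hl)
    rw [← h.left_eq_iff hv rfl ht hs, fst_key_eq_bot.2 ((h.isLeaf_left s).2 hs'),
      fst_key_eq_bot.2 ((h.isLeaf_left t).2 hl)]
  · have hcl := h.label_left.card_eq h.left (α.map_covBy _ _ (φ.map_covBy _ _ ht))
    have hcr := h.label_right.card_eq h.right (β.map_covBy _ _ (ψ.map_covBy _ _ ht))
    let F : {s : T // v ⋖ s ∧ α (φ s) = α (φ t)} → {s : T // v ⋖ s ∧ β (ψ s) = β (ψ t)} :=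
      fun s => ⟨s.1, s.2.1, hsub' s.1 s.2.1 s.2.2⟩
    have hF : Function.Injective F := fun s s' h1 => Subtype.ext (congrArg
      (fun z : {s : T // v ⋖ s ∧ β (ψ s) = β (ψ t)} => z.1) h1)
    have hle := Nat.card_le_card_of_injective F hF
    rw [key_of_isInternal (α.isInternal_map (φ.isInternal_map hi)),
      key_of_isInternal (Λ := Ξ.transpose) (β.isInternal_map (ψ.isInternal_map hi))] at hk ⊢
    rw [Prod.Lex.toLex_le_toLex, Prod.Lex.toLex_le_toLex]
    refine Or.inr ⟨hk, ?_⟩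
    simp only [transpose_card, hcl, hcr]
    refine hle.lt_or_eq.imp id fun heq => ⟨heq, hrow fun s hs h1 => ?_⟩
    obtain ⟨s', hs'⟩ := (hF.bijective_of_nat_card_le heq.ge).2 ⟨s, hs, h1⟩
    have h2 : s'.1 = s := congrArg (fun z : {s : T // v ⋖ s ∧ β (ψ s) = β (ψ t)} => z.1) hs'
    exact h2 ▸ s'.2.2

theorem comparison (h : SeparatedPair φ ψ α β) {n : ℕ} (hn : h.CodeRigid n) (hn' : h.CodeLE n)
    {v : T} (hv : HeightLE (n + 1) v) :
    Λ.code (n + 1) (α (φ v)) ≤ Ξ.transpose.code (n + 1) (β (ψ v)) ∧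
      (Λ.code (n + 1) (α (φ v)) = Ξ.transpose.code (n + 1) (β (ψ v)) →
        ∀ t, v ⋖ t → Λ.key n (α (φ t)) = Ξ.transpose.key n (β (ψ t))) := by
  have := Fintype.ofFinite {t // v ⋖ t}
  have main := toColex_le_of_enumeration (k := fun t : {t // v ⋖ t} => Λ.key n (α (φ t)))
    (l := fun t : {t // v ⋖ t} => Ξ.transpose.key n (β (ψ t)))
    (h.mem_keys_left n v) (h.mem_keys_right n v) ?_
    (fun t t' h1 => by
      rw [(h.left_eq_iff hv rfl t'.2 t.2).1 h1])
    (fun t t' h1 => by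
      rw [(h.right_eq_iff hv rfl t'.2 t.2).1 h1])
    (fun t h1 h2 => h.key_le_key hn hv t.2 h1 fun s hs => h2 ⟨s, hs⟩) ?_
  · exact ⟨main.1, fun h1 t ht => main.2 h1 ⟨t, ht⟩⟩
  · intro t
    rcases isLeaf_or_isInternal t.1 with hl | hi
    · rw [fst_key_eq_bot.2 ((h.isLeaf_left t).2 hl)]
      exact bot_le
    · rw [key_of_isInternal (α.isInternal_map (φ.isInternal_map hi)),
        key_of_isInternal (Λ := Ξ.transpose) (β.isInternal_map (ψ.isInternal_map hi))]
      exact WithBot.coe_le_coe.2 (hn' t (hv t t.2))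
  · intro t t' h1
    rcases key_eq_iff.1 h1 with ⟨h2, h3, -⟩ | ⟨h2, h3, -, h4⟩
    · rw [fst_key_eq_bot.2 h2]
      refine Nat.card_congr (Equiv.subtypeEquivRight fun s => ?_)
      rw [fst_key_eq_bot, fst_key_eq_bot, h.isLeaf_left]
      exact (h.isLeaf_right s).symm
    · rw [h.card_left hv t.2, h1, h.card_right hv t'.2, h4]

/-- Rigidity is needed to prove the inequality one level up. Equality of codes forces equality of
keys at every child, so corresponding children match bijectively and the isomorphisms given by
rigidity below are glued. -/
theorem codeLE_and_codeRigid (h : SeparatedPair φ ψ α β) (n : ℕ) :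
    h.CodeLE n ∧ h.CodeRigid n := by
  induction n with
  | zero =>
    exact ⟨fun v _ => le_rfl, fun v w hv hφ hψ _ => h.exists_iso_of_isLeaf hv hφ hψ⟩
  | succ n ih =>
    obtain ⟨hle, hrig⟩ := ih
    refine ⟨fun v hv => (h.comparison hrig hle hv).1, fun v w hv hφ hψ hcode => ?_⟩
    have hw : HeightLE (n + 1) w := by
      rw [← h.left.heightLE_iff, ← hφ, h.left.heightLE_iff]; exact hv
    have hkv := (h.comparison hrig hle hv).2 hcode
    have hkw := (h.comparison hrig hle hw).2 (by rw [← hφ, ← hψ]; exact hcode)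
    have hinj : ∀ {v s s' : T}, HeightLE (n + 1) v →
        (∀ t, v ⋖ t → Λ.key n (α (φ t)) = Ξ.transpose.key n (β (ψ t))) → v ⋖ s → v ⋖ s' →
        φ s = φ s' → ψ s = ψ s' → s = s' := fun hv hk hs hs' h1 h2 =>
      h.children_injective hrig hv hs hs' h1 h2 (by rw [hk _ hs])
    have hex : ∀ {v w : T}, HeightLE (n + 1) v → HeightLE (n + 1) w → φ v = φ w → ψ v = ψ w →
        (∀ t, v ⋖ t → Λ.key n (α (φ t)) = Ξ.transpose.key n (β (ψ t))) →
        (∀ t, w ⋖ t → Λ.key n (α (φ t)) = Ξ.transpose.key n (β (ψ t))) →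
        ∀ t, v ⋖ t → ∃ t', w ⋖ t' ∧ φ t' = φ t ∧ ψ t' = ψ t := by
      intro v w hv hw hφ hψ hkv hkw t ht
      refine h.exists_corresponding_child ht hφ hψ (fun s hs => ?_) (fun s s' hs _ h1 h2 => ?_) ?_
      · rcases hs with hs | hs
        · rw [← h.left_eq_iff hv rfl ht hs, ← h.right_eq_iff hv rfl ht hs, hkv s hs, hkv t ht]
        · rw [← h.left_eq_iff hv hφ ht hs, ← h.right_eq_iff hv hψ ht hs, hkw s hs, hkv t ht]
      · rcases hs with hs | hs
        · exact hinj hv hkv hs.1 hs.2 h1 h2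
        · exact hinj hw hkw hs.1 hs.2 h1 h2
      · rcases key_eq_iff.1 (hkv t ht) with h1 | h1
        · exact h1.2.2
        · exact h1.2.2.2
    choose f hf hfφ hfψ using hex hv hw hφ hψ hkv hkw
    let F : {t // v ⋖ t} → {t // w ⋖ t} := fun t => ⟨f t t.2, hf t t.2⟩
    have hF : Function.Bijective F := by
      refine ⟨fun t t' h1 => Subtype.ext (hinj hv hkv t.2 t'.2 ?_ ?_), fun t' => ?_⟩
      · have h2 : f t t.2 = f t' t'.2 := congrArg Subtype.val h1
        rw [← hfφ t t.2, ← hfφ t' t'.2, h2]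
      · have h2 : f t t.2 = f t' t'.2 := congrArg Subtype.val h1
        rw [← hfψ t t.2, ← hfψ t' t'.2, h2]
      · obtain ⟨t, ht, h1, h2⟩ := hex hw hv hφ.symm hψ.symm hkw hkv t' t'.2
        refine ⟨⟨t, ht⟩, Subtype.ext (hinj hw hkw (hf t ht) t'.2 ?_ ?_)⟩
        · rw [hfφ, h1]
        · rw [hfψ, h2]
    have hζ : ∀ t : {t // v ⋖ t}, ∃ ζ : sub T t.1 ≃o sub T (F t).1,
        ∀ s : sub T t.1, φ (ζ s) = φ s ∧ ψ (ζ s) = ψ s := fun t =>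
      h.exists_iso_of_key_eq hrig (hv t t.2) (hfφ t t.2).symm (hfψ t t.2).symm (by
        rw [hkv t t.2])
    choose ζ hζ using hζ
    obtain ⟨Z, hZ⟩ := exists_glued_iso (Equiv.ofBijective F hF) ζ
    refine ⟨Z, fun s => ?_⟩
    by_cases hs : (s : T) = v
    · obtain rfl : s = ⟨v, le_rfl⟩ := Subtype.ext hs
      rw [subIso_root Z]
      exact ⟨hφ.symm, hψ.symm⟩
    · obtain ⟨c, hc, hcs⟩ := exists_child_le (lt_of_le_of_ne s.2 (Ne.symm hs))
      have h1 := hZ ⟨c, hc⟩ s hcs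
      rw [h1]
      exact hζ ⟨c, hc⟩ ⟨s, hcs⟩

/-- The tree of partitions of the first composition is at most the conjugate of the tree of
partitions of the second one. -/
theorem transpose_ge (h : SeparatedPair φ ψ α β) : Ξ.transpose.GE Λ := by
  set H := max (height Ξ.transpose.tree) (height Λ.tree) with hH
  have h1 : HeightLE H (⊥ : Λ.tree) := heightLE_height.mono (le_max_right _ _)
  have h2 : HeightLE H (⊥ : Ξ.transpose.tree) := heightLE_height.mono (le_max_left _ _)
  have h3 := (h.codeLE_and_codeRigid H).1 ⊥ (by
    rw [← h.heightLE_left, φ.map_bot, α.map_bot]; exact h1)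
  rw [φ.map_bot, α.map_bot, ψ.map_bot, β.map_bot] at h3
  rcases h3.lt_or_eq with h4 | h4
  · exact Or.inl (gtAt_of_code_lt h.good_right h.good_left h2 h1 h4)
  · exact Or.inr ((Ξ.transpose.sub_bot_iso.symm.trans
      (iso_of_code_eq h.good_right h.good_left h2 h1 h4.symm)).trans Λ.sub_bot_iso)

end SeparatedPair

theorem compLE_transpose {M' : RootedTree.{u}} [Finite T] {φ : TreeHom T P} {ψ : TreeHom T M}
    (hφ : IsComposition φ) (hψ : IsComposition ψ) (hsep : JointlySeparated φ ψ)
    {ψt : TreeHom T M'} (ht : IsTranspose ψ ψt) : CompLE φ ψt := by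
  obtain ⟨-, ⟨Q, β, βt, lab, hβ, hlab, hβt, hlabt, -⟩, -⟩ := ht
  obtain ⟨Λ, α, hα, hΛ⟩ := hφ.exists_treeOfPartitions
  have hfin : Finite Λ.tree :=
    Finite.of_surjective _ (hα.composition.surjective.comp hφ.surjective)
  have hfin' : Finite Q := Finite.of_surjective _ (hβ.composition.surjective.comp hψ.surjective)
  -- The labeling of `ψ` is the one supplied with the transpose, so that its conjugate is literally
  -- a tree of partitions of `ψt`.
  let Ξ : Labeling.{u} := ⟨Q, lab⟩
  have hfin'' : Finite Ξ.tree := hfin'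
  have h : SeparatedPair (Ξ := Ξ) φ ψ α β := ⟨hφ, hψ, hα, hβ, hΛ, hlab, hsep⟩
  exact ⟨Λ, Ξ.transpose, ⟨α, hα, hΛ⟩, ⟨βt, hβt, hlabt⟩, h.transpose_ge⟩

theorem JointlySeparated.symm {φ : TreeHom T P} {ψ : TreeHom T M} (h : JointlySeparated φ ψ) :
    JointlySeparated ψ φ := fun v w hvw hψ hφ ζ hζ =>
  h v w hvw hφ hψ ζ fun t => ⟨(hζ t).2, (hζ t).1⟩

end Main

end TreeComp

theorem mainTheorem10 {T P M : RootedTree.{u}} [Finite T]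
    (φ : TreeComp.TreeHom T P) (ψ : TreeComp.TreeHom T M)
    (hφ : TreeComp.IsComposition φ) (hψ : TreeComp.IsComposition ψ)
    (htriv : TreeComp.TrivialCoarsestCommonRefinement φ ψ) :
    (∀ (M' : RootedTree.{u}) (ψt : TreeComp.TreeHom T M'),
      TreeComp.IsTranspose ψ ψt → TreeComp.CompLE φ ψt) ∧
    (∀ (P' : RootedTree.{u}) (φt : TreeComp.TreeHom T P'),
      TreeComp.IsTranspose φ φt → TreeComp.CompLE ψ φt) := by
  have hsep := htriv.jointlySeparated
  exact ⟨fun _ _ ht => TreeComp.compLE_transpose hφ hψ hsep ht,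
    fun _ _ ht => TreeComp.compLE_transpose hψ hφ hsep.symm ht⟩
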